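/- Let $d\in\{2,3\}$, let $\Omega\subset\mathbb{R}^d$ be a simply connected polygonal/polyhedral domain, and let $\mathcal{T}_h$ be a conforming partition of $\Omega$ into finitely many nonoverlapping simplices (any two distinct elements are disjoint or meet in a common lower-dimensional face). It is shape-regular with parameter $\kappa$, i.e. the diameter $h_K$ of every $K\in\mathcal{T}_h$ is at most $\kappa$ times the diameter of some ball contained in $K$. Write $\mathcal{E}(K)$ for the set of facets of $K$, $\mathcal{E}_h$ for the set of all facets, $\mathbf{n}$ for the outward unit normal on $\partial K$, $(\cdot,\cdot)_K$ and $\|\cdot\|_K$ for the $L^2$ inner product and norm on $K$, and $\langle\cdot,\cdot\rangle_{\partial K}$ for the $L^2$ inner product on $\partial K$ (a sum over $\mathcal{E}(K)$). Let $a$ be strictly positive and constant on each element, let $f\in L^2(\Omega)$, and let $u\in H^1_0(\Omega)$, $\boldsymbol\sigma=a\nabla u$ be the weak solution of $-\nabla\cdot\boldsymbol\sigma=f$ in $\Omega$, $u=0$ on $\partial\Omega$. Let $k\ge 0$. For every $K\in\mathcal{T}_h$ choose a facet $F_K^*\in\mathcal{E}(K)$, and let the stabilization parameter be $\alpha_h|_F=a|_K$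 if $F=F_K^*$ and $\alpha_h|_F=0$ if $F\in\mathcal{E}(K)$, $F\neq F_K^*$ (so $\alpha_h$ may take different values on the two sides of an interior facet). Let $(\boldsymbol\sigma_h,u_h,\widehat u_h)\in\mathbb{X}_{h,k}$ be a mixed HDG approximation, where $\mathbb{X}_{h,k}$ is the space of triples $(\boldsymbol\tau,v,\widehat v)$ such that $\boldsymbol\tau|_K\in\mathbb{P}_k(K)^d$ and $v|_K\in\mathbb{P}_k(K)$ for all $K\in\mathcal{T}_h$, $\widehat v|_F\in\mathbb{P}_k(F)$ for all $F\in\mathcal{E}_h$, and $\widehat v|_F=0$ for all $F\subset\partial\Omega$; that is, for all $(\boldsymbol\tau,v,\widehat v)\in\mathbb{X}_{h,k}$, $$\sum_{K\in\mathcal{T}_h}\Big\{(a^{-1}\boldsymbol\sigma_h,\boldsymbol\tau)_K+(u_h,\nabla\cdot\boldsymbol\tau)_K-\langle\widehat u_h,\boldsymbol\tau\cdot\mathbf{n}\rangle_{\partial K}+(\boldsymbol\sigma_h,\nabla v)_K-\langle\boldsymbol\sigma_h\cdot\mathbf{n}-\alpha_h(u_h-\widehat u_h),v-\widehat v\rangle_{\partial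 K}\Big\}=\sum_{K\in\mathcal{T}_h}(f,v)_K .$$ Define the seminorms $$|||(\boldsymbol\tau,v,\widehat v)|||_{mx}=\Big(\sum_{K\in\mathcal{T}_h}(a^{-1}\boldsymbol\tau,\boldsymbol\tau)_K\Big)^{1/2},\qquad |||(\boldsymbol\tau,v,\widehat v)|||_{HDG,mx}=\Big(|||(\boldsymbol\tau,v,\widehat v)|||_{mx}^2+\sum_{K\in\mathcal{T}_h}h_K\langle\alpha_h(v-\widehat v),v-\widehat v\rangle_{\partial K}\Big)^{1/2},$$ where on $\partial K$ the function $v$ means the trace of $v|_K$, the data oscillation $$\mathrm{osc}_k(f,K)=(a|_K)^{-1/2}\,h_K\inf_{p\in\mathbb{P}_k}\|f-p\|_K ,$$ and the error $E=(\boldsymbol\sigma-\boldsymbol\sigma_h,\;u-u_h,\;u|_{\mathcal{E}_h}-\widehat u_h)$. Then $$|||E|||_{mx}\le|||E|||_{HDG,mx},$$ and there is a constant $c>0$, depending only on $d$, $k$ and the shape-regularity parameter $\kappa$, such that $$c\,|||E|||_{HDG,mx}^2\le|||E|||_{mx}^2+\sum_{K\in\mathcal{T}_h}\mathrm{osc}_k(f,K)^2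 .$$ -/

import Mathlib

open MeasureTheory Filter Topology
open scoped ContDiff ENNReal

namespace HDG

noncomputable section

/-- The ambient Euclidean space `ℝ^d`. -/
abbrev Space (d : ℕ) : Type := EuclideanSpace ℝ (Fin d)

/-! ### Simplicial meshes -/

/-- The closed simplex (element, or facet) spanned by a finite set of vertices. -/
def hull {d : ℕ} (S : Finset (Space d)) : Set (Space d) :=
  convexHull ℝ (S : Set (Space d))

/-- A finite conforming simplicial mesh in `ℝ^d`. An element is recorded through its `d + 1`
affinely independent vertices; two elements meet in the (possibly empty) common face that is
spanned by their common vertices. -/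
structure Mesh (d : ℕ) where
  /-- the elements -/
  cells : Finset (Finset (Space d))
  card_cell : ∀ K ∈ cells, K.card = d + 1
  indep : ∀ K ∈ cells, AffineIndependent ℝ ((↑) : K → Space d)
  conforming : ∀ K ∈ cells, ∀ K' ∈ cells,
    hull K ∩ hull K' = convexHull ℝ ((K : Set (Space d)) ∩ (K' : Set (Space d)))

/-- The facets of the element `K`: the sets of `d` of its `d + 1` vertices. -/
def cellFacets {d : ℕ} (K : Finset (Space d)) : Finset (Finset (Space d)) :=
  K.powersetCard d

/-- All the facets of the mesh. -/
def Mesh.facets {d : ℕ} (T : Mesh d) : Set (Finset (Space d)) :=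
  {F | ∃ K ∈ T.cells, F ∈ cellFacets K}

/-- `T` is a partition of the domain `Ω`: the closed elements fill up the closure of `Ω`, and
the open elements lie in `Ω`. -/
def Mesh.Triangulates {d : ℕ} (T : Mesh d) (Ω : Set (Space d)) : Prop :=
  closure Ω = ⋃ K ∈ T.cells, hull K ∧ ∀ K ∈ T.cells, interior (hull K) ⊆ Ω

/-- The diameter `h_K`. -/
def meshSize {d : ℕ} (K : Finset (Space d)) : ℝ := Metric.diam (hull K)

/-- Shape regularity with parameter `κ`: every element `K` contains a ball whose diameter
`2 r` satisfies `h_K ≤ κ (2 r)`. -/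
def Mesh.ShapeRegular {d : ℕ} (T : Mesh d) (κ : ℝ) : Prop :=
  ∀ K ∈ T.cells, ∃ (x : Space d) (r : ℝ),
    0 < r ∧ Metric.closedBall x r ⊆ hull K ∧ meshSize K ≤ κ * (2 * r)

/-- Lebesgue measure on the element `K`. -/
def cellMeasure {d : ℕ} (K : Finset (Space d)) : Measure (Space d) :=
  volume.restrict (hull K)

/-- Surface measure (the normalized `(d-1)`-dimensional Hausdorff measure) on the facet `F`. -/
def facetMeasure {d : ℕ} (F : Finset (Space d)) : Measure (Space d) :=
  (Measure.euclideanHausdorffMeasure (d - 1)).restrict (hull F)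

/-- `n` is the unit normal on the facet `F` of `K` which points out of `K`. -/
def IsOutwardNormal {d : ℕ} (K F : Finset (Space d)) (n : Space d) : Prop :=
  ‖n‖ = 1 ∧ (∀ x ∈ F, ∀ y ∈ F, inner ℝ n (y - x) = 0) ∧
    ∀ x ∈ F, ∀ y ∈ K, y ∉ F → inner ℝ n (y - x) < 0

/-- The outward unit normal of `K` on its facet `F`. -/
def outwardNormal {d : ℕ} (K F : Finset (Space d)) : Space d :=
  Classical.epsilon (IsOutwardNormal K F)

/-! ### Sobolev functions and traces -/

/-- `u ∈ H^1_0(Ω)` with weak gradient `G`: `(u, G)` is the limit in `L²(Ω)` of `(φ_n, ∇φ_n)`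
with `φ_n` smooth and compactly supported in `Ω`. -/
def IsH10 {d : ℕ} (Ω : Set (Space d)) (u : Space d → ℝ) (G : Space d → Space d) : Prop :=
  MemLp u 2 (volume.restrict Ω) ∧ MemLp G 2 (volume.restrict Ω) ∧
    ∃ φ : ℕ → Space d → ℝ,
      (∀ n, ContDiff ℝ ∞ (φ n) ∧ HasCompactSupport (φ n) ∧ tsupport (φ n) ⊆ Ω) ∧
      Tendsto (fun n => eLpNorm (fun x => φ n x - u x) 2 (volume.restrict Ω)) atTop (𝓝 0) ∧
      Tendsto (fun n => eLpNorm (fun x => gradient (φ n) x - G x) 2 (volume.restrict Ω))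
        atTop (𝓝 0)

/-- `g ∈ L²(F)` is the trace on the facet `F` of the function `v ∈ H^1(K)`: smooth functions
`φ_n` converge to `v` in `H^1(K)`, and their restrictions to `F` converge to `g` in `L²(F)`. -/
def IsFacetTrace {d : ℕ} (K F : Finset (Space d)) (v g : Space d → ℝ) : Prop :=
  MemLp g 2 (facetMeasure F) ∧
    ∃ (φ : ℕ → Space d → ℝ) (G : Space d → Space d),
      (∀ n, ContDiff ℝ ∞ (φ n)) ∧ MemLp G 2 (cellMeasure K) ∧
      Tendsto (fun n => eLpNorm (fun x => φ n x - v x) 2 (cellMeasure K)) atTop (𝓝 0) ∧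
      Tendsto (fun n => eLpNorm (fun x => gradient (φ n) x - G x) 2 (cellMeasure K))
        atTop (𝓝 0) ∧
      Tendsto (fun n => eLpNorm (fun x => φ n x - g x) 2 (facetMeasure F)) atTop (𝓝 0)

/-- The trace on the facet `F` of `v ∈ H^1(K)`, taken from the element `K`
(a representative of its class in `L²(F)`). -/
def facetTrace {d : ℕ} (K F : Finset (Space d)) (v : Space d → ℝ) : Space d → ℝ :=
  Classical.epsilon (IsFacetTrace K F v)

/-- The restriction of `v ∈ H^1(Ω)` to the mesh skeleton: on every facet `F`, the common trace
of `v` from all the elements that have `F` as a facet. -/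
def skeletonTrace {d : ℕ} (T : Mesh d) (v : Space d → ℝ) (F : Finset (Space d)) :
    Space d → ℝ :=
  Classical.epsilon fun g => ∀ K ∈ T.cells, F ∈ cellFacets K → IsFacetTrace K F v g

/-! ### The model problem -/

/-- The datum `a` is strictly positive and constant, equal to `aK K`, on every element `K`. -/
def IsPiecewiseConstant {d : ℕ} (T : Mesh d) (a : Space d → ℝ)
    (aK : Finset (Space d) → ℝ) : Prop :=
  ∀ K ∈ T.cells, 0 < aK K ∧ ∀ x ∈ interior (hull K), a x = aK K

/-- `(σ, u)` is the weak solution of `σ = a ∇u`, `-div σ = f` in `Ω`, `u = 0` on `∂Ω`. -/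
def IsWeakSolution {d : ℕ} (Ω : Set (Space d)) (a f : Space d → ℝ)
    (σ : Space d → Space d) (u : Space d → ℝ) : Prop :=
  ∃ G : Space d → Space d, IsH10 Ω u G ∧
    (∀ᵐ x ∂(volume.restrict Ω), σ x = a x • G x) ∧
    ∀ φ : Space d → ℝ, ContDiff ℝ ∞ φ → HasCompactSupport φ → tsupport φ ⊆ Ω →
      ∫ x in Ω, inner ℝ (σ x) (gradient φ x) = ∫ x in Ω, f x * φ x

/-! ### Discrete spaces and the mixed HDG method -/

/-- The value of a polynomial at a point. -/
def polyVal {d : ℕ} (p : MvPolynomial (Fin d) ℝ) (x : Space d) : ℝ :=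
  MvPolynomial.eval (fun i => x i) p

/-- The value of a vector of polynomials at a point. -/
def polyVec {d : ℕ} (p : Fin d → MvPolynomial (Fin d) ℝ) (x : Space d) : Space d :=
  WithLp.toLp 2 fun i => polyVal (p i) x

/-- The divergence of a polynomial vector field. -/
def polyDiv {d : ℕ} (p : Fin d → MvPolynomial (Fin d) ℝ) (x : Space d) : ℝ :=
  ∑ i, polyVal (MvPolynomial.pderiv i (p i)) x

/-- The gradient of a polynomial. -/
def polyGrad {d : ℕ} (p : MvPolynomial (Fin d) ℝ) (x : Space d) : Space d :=
  polyVec (fun i => MvPolynomial.pderiv i p) x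

/-- A discrete triple `(σ, u, û)`: polynomials on every element and on every facet. A polynomial
on a facet `F` is the restriction to `F` of a polynomial on `ℝ^d`. Only the values at the
elements and the facets of a mesh are meaningful. -/
structure DiscreteTriple (d : ℕ) where
  /-- the flux `σ` on each element -/
  flux : Finset (Space d) → Fin d → MvPolynomial (Fin d) ℝ
  /-- the potential `u` on each element -/
  pot : Finset (Space d) → MvPolynomial (Fin d) ℝ
  /-- the potential `û` on each facet -/
  hat : Finset (Space d) → MvPolynomial (Fin d) ℝ

/-- Membership in `Σ_{h,k} × V_{h,k} × M_{h,k}^0`: all degrees are at most `k`, and `û` vanishes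
on the facets that lie on the boundary of `Ω`. -/
def DiscreteTriple.Mem {d : ℕ} (X : DiscreteTriple d) (T : Mesh d) (Ω : Set (Space d))
    (k : ℕ) : Prop :=
  (∀ K ∈ T.cells, ∀ i, (X.flux K i).totalDegree ≤ k) ∧
  (∀ K ∈ T.cells, (X.pot K).totalDegree ≤ k) ∧
  (∀ F ∈ T.facets, (X.hat F).totalDegree ≤ k) ∧
  (∀ F ∈ T.facets, hull F ⊆ frontier Ω → ∀ x ∈ hull F, polyVal (X.hat F) x = 0)

/-- The bilinear form of the mixed HDG method, with stabilization parameter `α K F` on the facet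
`F` of the element `K`. -/
def bilinearForm {d : ℕ} (T : Mesh d) (aK : Finset (Space d) → ℝ)
    (α : Finset (Space d) → Finset (Space d) → ℝ) (X Y : DiscreteTriple d) : ℝ :=
  ∑ K ∈ T.cells,
    ((∫ x, (aK K)⁻¹ * inner ℝ (polyVec (X.flux K) x) (polyVec (Y.flux K) x) ∂(cellMeasure K))
      + (∫ x, polyVal (X.pot K) x * polyDiv (Y.flux K) x ∂(cellMeasure K))
      - (∑ F ∈ cellFacets K, ∫ x, polyVal (X.hat F) x *
          inner ℝ (polyVec (Y.flux K) x) (outwardNormal K F) ∂(facetMeasure F))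
      + (∫ x, inner ℝ (polyVec (X.flux K) x) (polyGrad (Y.pot K) x) ∂(cellMeasure K))
      - (∑ F ∈ cellFacets K, ∫ x,
          (inner ℝ (polyVec (X.flux K) x) (outwardNormal K F)
            - α K F * (polyVal (X.pot K) x - polyVal (X.hat F) x))
          * (polyVal (Y.pot K) x - polyVal (Y.hat F) x) ∂(facetMeasure F)))

/-- The linear form of the mixed HDG method. -/
def linearForm {d : ℕ} (T : Mesh d) (f : Space d → ℝ) (Y : DiscreteTriple d) : ℝ :=
  ∑ K ∈ T.cells, ∫ x, f x * polyVal (Y.pot K) x ∂(cellMeasure K)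

/-- `X = (σ_h, u_h, û_h)` solves the mixed HDG equations of degree `k`. -/
def IsMixedHDGSolution {d : ℕ} (T : Mesh d) (Ω : Set (Space d)) (k : ℕ)
    (aK : Finset (Space d) → ℝ) (α : Finset (Space d) → Finset (Space d) → ℝ)
    (f : Space d → ℝ) (X : DiscreteTriple d) : Prop :=
  X.Mem T Ω k ∧ ∀ Y : DiscreteTriple d, Y.Mem T Ω k →
    bilinearForm T aK α X Y = linearForm T f Y

open Classical in
/-- Single-facet stabilization: `α` is `a|_K` on the chosen facet `Fstar K` of `K`, and `0` on
the other facets of `K`. -/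
def singleFacetStabilization {d : ℕ} (aK : Finset (Space d) → ℝ)
    (Fstar : Finset (Space d) → Finset (Space d)) (K F : Finset (Space d)) : ℝ :=
  if F = Fstar K then aK K else 0

/-! ### The energy seminorms and the data oscillation -/

/-- A triple `(τ, v, v̂)` of a flux and a potential on each element, and a potential on each
facet. -/
structure BrokenTriple (d : ℕ) where
  /-- the flux `τ` on each element -/
  flux : Finset (Space d) → Space d → Space d
  /-- the potential `v` on each element -/
  pot : Finset (Space d) → Space d → ℝ
  /-- the potential `v̂` on each facet -/
  hat : Finset (Space d) → Space d → ℝ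

/-- The error `(σ - σ_h, u - u_h, u|_{skeleton} - û_h)`. -/
def errorTriple {d : ℕ} (T : Mesh d) (σ : Space d → Space d) (u : Space d → ℝ)
    (X : DiscreteTriple d) : BrokenTriple d where
  flux K x := σ x - polyVec (X.flux K) x
  pot K x := u x - polyVal (X.pot K) x
  hat F x := skeletonTrace T u F x - polyVal (X.hat F) x

/-- The broken energy seminorm `(∑_K (a⁻¹ τ, τ)_K)^{1/2}`. -/
def brokenSeminorm {d : ℕ} (T : Mesh d) (aK : Finset (Space d) → ℝ)
    (e : BrokenTriple d) : ℝ :=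
  Real.sqrt (∑ K ∈ T.cells,
    ∫ x, (aK K)⁻¹ * inner ℝ (e.flux K x) (e.flux K x) ∂(cellMeasure K))

/-- The mixed HDG energy seminorm: the square root of the squared broken energy seminorm plus
`∑_K h_K ⟨α (v - v̂), v - v̂⟩_{∂K}`, where `v` on `∂K` is the trace of `v|_K`. -/
def hdgSeminorm {d : ℕ} (T : Mesh d) (aK : Finset (Space d) → ℝ)
    (α : Finset (Space d) → Finset (Space d) → ℝ) (e : BrokenTriple d) : ℝ :=
  Real.sqrt (brokenSeminorm T aK e ^ 2 +
    ∑ K ∈ T.cells, meshSize K * ∑ F ∈ cellFacets K,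
      ∫ x, α K F * (facetTrace K F (e.pot K) x - e.hat F x) ^ 2 ∂(facetMeasure F))

/-- The data oscillation
`osc_k(f, K) = a^{-1/2} h_K inf { ‖f - p‖_{L²(K)} : p polynomial of degree at most k }`. -/
def osc {d : ℕ} (aK : Finset (Space d) → ℝ) (k : ℕ) (f : Space d → ℝ)
    (K : Finset (Space d)) : ℝ :=
  (Real.sqrt (aK K))⁻¹ * meshSize K *
    ⨅ p : {p : MvPolynomial (Fin d) ℝ // p.totalDegree ≤ k},
      Real.sqrt (∫ x, (f x - polyVal p.1 x) ^ 2 ∂(cellMeasure K))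

end

end HDG

/-!
The two seminorms differ by the stabilization terms `h_K a_K ‖(u - u_h) - (u - û_h)‖²` on the
facets `F = Fstar K`, so the first inequality is clear, and for the second it is enough to bound
each of these terms by the flux error and the oscillation on the same element `K`.

The traces of `u` cancel in the stabilization term (`facetTrace_sub_skeletonTrace`): what remains
is the polynomial jump `w = u_h - û_h` on `F`. For this the trace of a function of `H¹₀(Ω)` has to
exist, to be common to neighbouring elements, and to be unique up to null sets. All three follow
from the multiplicative trace inequality `IsSimplex.exists_trace_inequality`; because it is
multiplicative, uniqueness does not need the uniqueness of weak gradients.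

Testing the HDG equations with a potential `v` that lives on `K` only and integrating by parts
gives `a_K ∫_F w v = ∫_K (f + div σ_h) v` (`integral_jump_mul_eq`). The polynomial `v` is taken to
be `w ∘ A`, where `A` is the affine retraction of `K` onto `F` that sends the opposite vertex to a
vertex of `F`. Then `v = w` on `F` and `‖v‖²_K ≤ h_K ‖w‖²_F` by Fubini, without any constant
(`IsSimplex.integral_comp_retraction_le`), and so `h_K a_K ‖w‖²_F` is bounded by `a_K⁻¹ h_K² (‖f -
p‖_K + ‖p + div σ_h‖_K)²` for every polynomial `p` (`sq_mul_sq_jump_le`). The residual `p + div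
σ_h` is a polynomial, and the bubble function technique bounds its norm by `‖f - p‖_K + h_K⁻¹ ‖σ -
σ_h‖_K` up to a constant (`exists_residual_bound`). The bubble is a smooth cut-off function on a
ball inside `K`; scaling this ball to the unit ball puts the image of `K` inside a ball whose
radius is determined by `κ`, so that no reference simplex is needed and the constant comes from
the equivalence of norms on polynomials of degree at most `k` (`exists_unit_inverse_estimate`).

The divergence theorem on a simplex is linear in the direction of the field, and edge directions
span. Along the edge `v - w` every line enters through the facet opposite to `v` and leaves
through the one opposite to `w`, so that the fundamental theorem of calculus applies once Lebesgue
measure is disintegrated over a hyperplane in an oblique direction (`map_hyperplaneMeasure_prod`)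
and the surface measures of the two facets are compared (`map_obliqueProj_hyperplaneMeasure`).
-/

namespace HDG

noncomputable section

/-! ### Surface measure on hyperplanes -/

/-- The hyperplane `{x | ⟨n, x⟩ = c}`. -/
def hyperplane {d : ℕ} (n : Space d) (c : ℝ) : Set (Space d) := {x | inner ℝ n x = c}

/-- Surface measure on the hyperplane `{x | ⟨n, x⟩ = c}`. -/
def hyperplaneMeasure {d : ℕ} (n : Space d) (c : ℝ) : Measure (Space d) :=
  (Measure.euclideanHausdorffMeasure (d - 1)).restrict (hyperplane n c)

lemma isClosed_hyperplane {d : ℕ} (n : Space d) (c : ℝ) : IsClosed (hyperplane n c) :=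
  isClosed_eq (by fun_prop) continuous_const

lemma hyperplaneMeasure_eq_map {d : ℕ} {n : Space d} (hn : ‖n‖ = 1) (c : ℝ) :
    hyperplaneMeasure n c =
      (volume : Measure (ℝ ∙ n)ᗮ).map (fun w : (ℝ ∙ n)ᗮ => (w : Space d) + c • n) := by
  have hiso : Isometry (fun w : (ℝ ∙ n)ᗮ => (w : Space d) + c • n) :=
    (isometry_add_right (c • n)).comp isometry_subtype_coe
  have hn0 : n ≠ 0 := by rintro rfl; simp at hn
  have hrank : Module.finrank ℝ (ℝ ∙ n)ᗮ = d - 1 := by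
    have h := (ℝ ∙ n).finrank_add_finrank_orthogonal
    rw [finrank_span_singleton hn0, finrank_euclideanSpace_fin] at h
    omega
  rw [← InnerProductSpace.euclideanHausdorffMeasure_eq_volume, hiso.map_euclideanHausdorffMeasure,
    hrank, hyperplaneMeasure]
  congr 1
  ext x
  simp only [hyperplane, Set.mem_ofPred_eq, Set.mem_range]
  constructor
  · intro h
    refine ⟨⟨x - c • n, ?_⟩, by simp⟩
    rw [Submodule.mem_orthogonal_singleton_iff_inner_right, inner_sub_right, h, inner_smul_right,
      real_inner_self_eq_norm_sq, hn]
    ring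
  · rintro ⟨w, rfl⟩
    rw [inner_add_right, Submodule.mem_orthogonal_singleton_iff_inner_right.1 w.2, inner_smul_right,
      real_inner_self_eq_norm_sq, hn]
    ring

lemma sFinite_hyperplaneMeasure {d : ℕ} {n : Space d} (hn : ‖n‖ = 1) (c : ℝ) :
    SFinite (hyperplaneMeasure n c) := by
  rw [hyperplaneMeasure_eq_map hn]
  infer_instance

lemma hyperplaneMeasure_lt_top {d : ℕ} {n : Space d} (hn : ‖n‖ = 1) (c : ℝ) {S : Set (Space d)}
    (hS : IsCompact S) : hyperplaneMeasure n c S < ⊤ := by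
  have hiso : Isometry (fun w : (ℝ ∙ n)ᗮ => (w : Space d) + c • n) :=
    (isometry_add_right (c • n)).comp isometry_subtype_coe
  rw [hyperplaneMeasure_eq_map hn, Measure.map_apply hiso.continuous.measurable hS.measurableSet]
  refine IsCompact.measure_lt_top ?_
  refine Metric.isCompact_of_isClosed_isBounded (hS.isClosed.preimage hiso.continuous) ?_
  exact hiso.antilipschitz.isBounded_preimage hS.isBounded

lemma volume_eq_lintegral_hyperplane {d : ℕ} {n : Space d} (hn : ‖n‖ = 1) {t : Set (Space d)}
    (ht : MeasurableSet t) :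
    volume t = ∫⁻ s : ℝ, Measure.euclideanHausdorffMeasure (d - 1) (t ∩ hyperplane n s) := by
  have hn0 : n ≠ 0 := by rintro rfl; simp at hn
  have h := EuclideanGeometry.euclideanHausdorffMeasure_eq_lintegral (V := Space d)
    (0 : Space d) hn0 ht
  rw [finrank_euclideanSpace_fin, EuclideanSpace.euclideanHausdorffMeasure_eq_volume] at h
  have hn1 : ‖n‖ₑ = 1 := by rw [← ofReal_norm, hn]; simp
  rw [h, hn1, one_mul]
  refine lintegral_congr fun s => ?_
  congr 2
  ext x
  rw [SetLike.mem_coe, AffineSubspace.mem_mk', Submodule.mem_orthogonal_singleton_iff_inner_right]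
  simp only [vsub_eq_sub, vadd_eq_add, add_zero, inner_sub_right, inner_smul_right,
    real_inner_self_eq_norm_sq, hn, hyperplane, Set.mem_ofPred_eq]
  constructor <;> intro h <;> linarith

/-- Oblique Fubini: Lebesgue measure is disintegrated over a hyperplane along any direction `e`
transversal to it. -/
lemma map_hyperplaneMeasure_prod {d : ℕ} {n : Space d} (hn : ‖n‖ = 1) (c : ℝ) {e : Space d}
    (he : inner ℝ n e ≠ 0) :
    ((hyperplaneMeasure n c).prod (volume : Measure ℝ)).map
      (fun p : Space d × ℝ => p.1 + p.2 • e) = ENNReal.ofReal |(inner ℝ n e)⁻¹| • volume := by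
  have := sFinite_hyperplaneMeasure hn c
  have hmeas : Measurable (fun p : Space d × ℝ => p.1 + p.2 • e) := by fun_prop
  ext t ht
  rw [Measure.map_apply hmeas ht, Measure.prod_apply_symm (hmeas ht), Measure.smul_apply,
    volume_eq_lintegral_hyperplane hn ht, smul_eq_mul]
  set G : ℝ → ℝ≥0∞ := fun s => Measure.euclideanHausdorffMeasure (d - 1) (t ∩ hyperplane n s)
    with hG
  have key : ∀ s : ℝ, hyperplaneMeasure n c
      ((fun x => (x, s)) ⁻¹' ((fun p : Space d × ℝ => p.1 + p.2 • e) ⁻¹' t))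
      = G (s * inner ℝ n e + c) := by
    intro s
    have h1 : ((fun x => (x, s)) ⁻¹' ((fun p : Space d × ℝ => p.1 + p.2 • e) ⁻¹' t))
        = (fun x => x + s • e) ⁻¹' t := rfl
    rw [h1, hyperplaneMeasure, Measure.restrict_apply (ht.preimage (by fun_prop))]
    have h2 : (fun x => x + s • e) ⁻¹' t ∩ hyperplane n c
        = (fun x => x + s • e) ⁻¹' (t ∩ hyperplane n (s * inner ℝ n e + c)) := by
      ext x
      simp only [hyperplane, Set.mem_inter_iff, Set.mem_preimage, Set.mem_ofPred_eq,
        inner_add_right, inner_smul_right, add_comm (s * _), add_left_inj]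
    rw [h2, measure_preimage_add_right]
  simp_rw [key]
  have h3 := lintegral_add_right_eq_self (μ := (volume : Measure ℝ)) G c
  rw [← h3]
  have h4 : MeasurableEmbedding (fun s : ℝ => s * inner ℝ n e) :=
    (Homeomorph.mulRight₀ _ he).measurableEmbedding
  have h5 := h4.lintegral_map (μ := volume) (fun s => G (s + c))
  rw [Real.map_volume_mul_right he] at h5
  rw [← h5, lintegral_smul_measure, smul_eq_mul]

/-- The projection along `e` onto the hyperplane `{x | ⟨n, x⟩ = c}`. -/
def obliqueProj {d : ℕ} (n : Space d) (c : ℝ) (e x : Space d) : Space d :=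
  x + ((c - inner ℝ n x) / inner ℝ n e) • e

@[fun_prop]
lemma continuous_obliqueProj {d : ℕ} (n : Space d) (c : ℝ) (e : Space d) :
    Continuous (obliqueProj n c e) := by
  unfold obliqueProj
  fun_prop

lemma lintegral_hyperplaneMeasure_prod {d : ℕ} {n : Space d} (hn : ‖n‖ = 1) (c : ℝ) {e : Space d}
    (he : inner ℝ n e ≠ 0) {g : Space d → ℝ≥0∞} (hg : Measurable g) :
    ∫⁻ x, g x = ENNReal.ofReal |inner ℝ n e| *
      ∫⁻ y, (∫⁻ s : ℝ, g (y + s • e)) ∂(hyperplaneMeasure n c) := by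
  have := sFinite_hyperplaneMeasure hn c
  have h := congrArg (fun μ => ∫⁻ x, g x ∂μ) (map_hyperplaneMeasure_prod hn c he)
  beta_reduce at h
  rw [lintegral_map hg (by fun_prop), lintegral_smul_measure, lintegral_prod _ (by fun_prop)] at h
  rw [h, smul_eq_mul, ← mul_assoc, ← ENNReal.ofReal_mul (abs_nonneg _), ← abs_mul,
    mul_inv_cancel₀ he]
  simp

/-- The projection along `e` between two hyperplanes transversal to `e` preserves the surface
measures weighted by the cosines of the angles between `e` and the normals: both weighted
measures are the measure of the cylinder of height one over a set. -/
lemma map_obliqueProj_hyperplaneMeasure {d : ℕ} {n n' : Space d} (hn : ‖n‖ = 1) (hn' : ‖n'‖ = 1)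
    (c c' : ℝ) {e : Space d} (he : inner ℝ n e ≠ 0) (he' : inner ℝ n' e ≠ 0) :
    ENNReal.ofReal |inner ℝ n e| • (hyperplaneMeasure n c).map (obliqueProj n' c' e) =
      ENNReal.ofReal |inner ℝ n' e| • hyperplaneMeasure n' c' := by
  ext t ht
  have hm : Measurable (obliqueProj n' c' e) := (continuous_obliqueProj n' c' e).measurable
  rw [Measure.smul_apply, Measure.smul_apply, Measure.map_apply hm ht, smul_eq_mul, smul_eq_mul]
  set h : Space d → ℝ := fun x => (inner ℝ n' x - c') / inner ℝ n' e with hh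
  have hhm : Measurable h := by rw [hh]; fun_prop
  set g : Space d → ℝ≥0∞ :=
    (obliqueProj n' c' e ⁻¹' t ∩ h ⁻¹' Set.Icc 0 1).indicator 1 with hg
  have hset : MeasurableSet (obliqueProj n' c' e ⁻¹' t ∩ h ⁻¹' Set.Icc 0 1) :=
    (hm ht).inter (hhm measurableSet_Icc)
  have hgm : Measurable g := measurable_one.indicator hset
  have hproj : ∀ y (s : ℝ), obliqueProj n' c' e (y + s • e) = obliqueProj n' c' e y := by
    intro y s
    have : (c' - (inner ℝ n' y + s * inner ℝ n' e)) / inner ℝ n' e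
        = (c' - inner ℝ n' y) / inner ℝ n' e - s := by field_simp; ring
    rw [obliqueProj, obliqueProj, inner_add_right, inner_smul_right, this]
    module
  have hshift : ∀ y (s : ℝ), h (y + s • e) = h y + s := by
    intro y s
    simp only [hh, inner_add_right, inner_smul_right]
    field_simp
    ring
  have hint : ∀ y, ∫⁻ s : ℝ, g (y + s • e) = (obliqueProj n' c' e ⁻¹' t).indicator 1 y := by
    intro y
    have : ∀ s : ℝ, g (y + s • e) = (obliqueProj n' c' e ⁻¹' t).indicator 1 y *
        (Set.Icc (0 - h y) (1 - h y)).indicator 1 s := by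
      intro s
      by_cases h1 : obliqueProj n' c' e y ∈ t <;>
      by_cases h2 : s ∈ Set.Icc (0 - h y) (1 - h y)
      all_goals
        have h3 : (h y + s ∈ Set.Icc (0 : ℝ) 1) ↔ s ∈ Set.Icc (0 - h y) (1 - h y) := by
          simp only [Set.mem_Icc, sub_le_iff_le_add, le_sub_iff_add_le, add_comm]
        simp [hg, Set.indicator, hproj, hshift, h1, h3, -Set.mem_Icc]
    simp_rw [this]
    rw [lintegral_const_mul _ (measurable_one.indicator measurableSet_Icc),
      lintegral_indicator_one measurableSet_Icc, Real.volume_Icc]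
    simp
  have e1 := lintegral_hyperplaneMeasure_prod hn c he hgm
  have e2 := lintegral_hyperplaneMeasure_prod hn' c' he' hgm
  simp_rw [hint] at e1 e2
  rw [lintegral_indicator_one (hm ht)] at e1 e2
  rw [← e1, e2]
  congr 1
  rw [hyperplaneMeasure, Measure.restrict_apply (hm ht), Measure.restrict_apply ht]
  congr 1
  ext x
  simp only [Set.mem_inter_iff, Set.mem_preimage, hyperplane, Set.mem_ofPred_eq]
  refine and_congr_left fun hx => ?_
  simp [obliqueProj, hx]

/-! ### Barycentric coordinates and outward normals of a simplex -/

open Classical in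
/-- The facet of `K` opposite to its vertex `v`. -/
def oppositeFacet {d : ℕ} (K : Finset (Space d)) (v : Space d) : Finset (Space d) := K.erase v

lemma mem_oppositeFacet {d : ℕ} {K : Finset (Space d)} {v x : Space d} :
    x ∈ oppositeFacet K v ↔ x ≠ v ∧ x ∈ K := by
  simp [oppositeFacet]

lemma isCompact_hull {d : ℕ} (S : Finset (Space d)) : IsCompact (hull S) :=
  S.finite_toSet.isCompact_convexHull (𝕜 := ℝ)

/-- `K` is the vertex set of a nondegenerate `d`-simplex. -/
structure IsSimplex {d : ℕ} (K : Finset (Space d)) : Prop where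
  card : K.card = d + 1
  indep : AffineIndependent ℝ ((↑) : K → Space d)

lemma Mesh.isSimplex {d : ℕ} (T : Mesh d) {K : Finset (Space d)} (hK : K ∈ T.cells) :
    IsSimplex K := ⟨T.card_cell K hK, T.indep K hK⟩

lemma IsSimplex.mem_cellFacets_iff {d : ℕ} {K : Finset (Space d)} (hK : IsSimplex K)
    {F : Finset (Space d)} : F ∈ cellFacets K ↔ ∃ v ∈ K, oppositeFacet K v = F := by
  classical
  rw [cellFacets, Finset.mem_powersetCard]
  constructor
  · rintro ⟨hsub, hcard⟩
    have h1 : (K \ F).card = 1 := by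
      rw [Finset.card_sdiff_of_subset hsub, hcard, hK.card]; omega
    obtain ⟨v, hv⟩ := Finset.card_eq_one.1 h1
    have hvK : v ∈ K \ F := by simp [hv]
    refine ⟨v, (Finset.mem_sdiff.1 hvK).1, ?_⟩
    ext x
    rw [mem_oppositeFacet]
    constructor
    · rintro ⟨hxv, hxK⟩
      by_contra hx
      have : x ∈ K \ F := Finset.mem_sdiff.2 ⟨hxK, hx⟩
      rw [hv, Finset.mem_singleton] at this
      exact hxv this
    · exact fun hx => ⟨by rintro rfl; exact (Finset.mem_sdiff.1 hvK).2 hx, hsub hx⟩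
  · rintro ⟨v, hv, rfl⟩
    refine ⟨fun x hx => (mem_oppositeFacet.1 hx).2, ?_⟩
    have : oppositeFacet K v = K.erase v := by ext x; simp [mem_oppositeFacet]
    rw [this, Finset.card_erase_of_mem hv, hK.card]
    omega

lemma IsSimplex.sum_cellFacets {d : ℕ} {K : Finset (Space d)} (hK : IsSimplex K)
    (g : Finset (Space d) → ℝ) : ∑ F ∈ cellFacets K, g F = ∑ v ∈ K, g (oppositeFacet K v) := by
  classical
  have h : cellFacets K = K.image (oppositeFacet K) := by
    ext F
    rw [hK.mem_cellFacets_iff, Finset.mem_image]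
  rw [h, Finset.sum_image]
  intro v hv w hw hvw
  by_contra hne
  have : w ∈ oppositeFacet K v := mem_oppositeFacet.2 ⟨Ne.symm hne, hw⟩
  rw [show oppositeFacet K v = oppositeFacet K w from hvw, mem_oppositeFacet] at this
  exact this.1 rfl

/-- The vertices of a simplex as an affine basis of the space. -/
def IsSimplex.basis {d : ℕ} {K : Finset (Space d)} (hK : IsSimplex K) :
    AffineBasis K ℝ (Space d) where
  toFun := (↑)
  ind' := hK.indep
  tot' := by
    rw [hK.indep.affineSpan_eq_top_iff_card_eq_finrank_add_one]
    simp [hK.card]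

open Classical in
/-- The barycentric coordinate on the simplex `K` that belongs to the vertex `v`;
zero if `v` is not a vertex of `K`. -/
def IsSimplex.bary {d : ℕ} {K : Finset (Space d)} (hK : IsSimplex K) (v : Space d) :
    Space d →ᵃ[ℝ] ℝ :=
  if h : v ∈ K then hK.basis.coord ⟨v, h⟩ else 0

namespace IsSimplex
variable {d : ℕ} {K : Finset (Space d)} (hK : IsSimplex K)
include hK

@[fun_prop]
lemma continuous_bary (v : Space d) : Continuous (hK.bary v) :=
  (hK.bary v).continuous_of_finiteDimensional

lemma bary_self {v : Space d} (hv : v ∈ K) : hK.bary v v = 1 := by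
  rw [bary, dif_pos hv]
  exact hK.basis.coord_apply_eq ⟨v, hv⟩

lemma bary_of_ne {v w : Space d} (hw : w ∈ K) (h : w ≠ v) : hK.bary v w = 0 := by
  rw [bary]
  split_ifs with hv
  · exact hK.basis.coord_apply_ne (i := ⟨v, hv⟩) (j := ⟨w, hw⟩) (by simpa using Ne.symm h)
  · rfl

lemma sum_bary (x : Space d) : ∑ v ∈ K, hK.bary v x = 1 := by
  rw [← Finset.sum_coe_sort, ← hK.basis.sum_coord_apply_eq_one x]
  refine Finset.sum_congr rfl fun v _ => ?_
  rw [bary, dif_pos v.2]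

lemma sum_bary_smul (x : Space d) : ∑ v ∈ K, hK.bary v x • v = x := by
  conv_rhs => rw [← hK.basis.linear_combination_coord_eq_self x]
  rw [← Finset.sum_coe_sort]
  refine Finset.sum_congr rfl fun v _ => ?_
  rw [bary, dif_pos v.2]
  rfl

lemma mem_hull_iff {x : Space d} : x ∈ hull K ↔ ∀ v ∈ K, 0 ≤ hK.bary v x := by
  have h := hK.basis.convexHull_eq_nonneg_coord
  have h2 : Set.range hK.basis = (K : Set (Space d)) := Subtype.range_coe
  rw [h2] at h
  rw [hull, h]
  simp only [Set.mem_ofPred_eq, Subtype.forall]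
  refine forall₂_congr fun v hv => ?_
  rw [bary, dif_pos hv]

lemma mem_hull_oppositeFacet_iff {v x : Space d} :
    x ∈ hull (oppositeFacet K v) ↔ x ∈ hull K ∧ hK.bary v x = 0 := by
  constructor
  · intro hx
    refine ⟨convexHull_mono (fun y hy => (mem_oppositeFacet.1 hy).2) hx, ?_⟩
    have hconv : Convex ℝ {y : Space d | hK.bary v y = 0} :=
      (convex_singleton (0 : ℝ)).affine_preimage (hK.bary v)
    exact convexHull_min (fun y hy => hK.bary_of_ne (mem_oppositeFacet.1 hy).2
      (mem_oppositeFacet.1 hy).1) hconv hx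
  · rintro ⟨hx, hx0⟩
    rw [hK.mem_hull_iff] at hx
    have hsum : ∑ w ∈ oppositeFacet K v, hK.bary w x = 1 := by
      rw [← hK.sum_bary x]
      refine Finset.sum_subset (fun y hy => (mem_oppositeFacet.1 hy).2) fun y hy hy' => ?_
      have : y = v := by by_contra h; exact hy' (mem_oppositeFacet.2 ⟨h, hy⟩)
      rw [this, hx0]
    have hcomb : ∑ w ∈ oppositeFacet K v, hK.bary w x • w = x := by
      conv_rhs => rw [← hK.sum_bary_smul x]
      refine Finset.sum_subset (fun y hy => (mem_oppositeFacet.1 hy).2) fun y hy hy' => ?_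
      have : y = v := by by_contra h; exact hy' (mem_oppositeFacet.2 ⟨h, hy⟩)
      rw [this, hx0, zero_smul]
    rw [← hcomb]
    exact (convex_convexHull ℝ _).sum_mem (fun w hw => hx w (mem_oppositeFacet.1 hw).2) hsum
      fun w hw => subset_convexHull ℝ _ hw

/-- Moving along an edge direction changes only the barycentric coordinates of its endpoints. -/
lemma bary_add_smul (u x v w : Space d) (s : ℝ) :
    hK.bary u (x + s • (v - w)) = hK.bary u x + s * (hK.bary u v - hK.bary u w) := by
  have h1 : x + s • (v - w) = s • (v - w) +ᵥ x := by rw [vadd_eq_add, add_comm]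
  have h2 := (hK.bary u).linearMap_vsub v w
  rw [vsub_eq_sub, vsub_eq_sub] at h2
  rw [h1, AffineMap.map_vadd, map_smul, h2, vadd_eq_add, smul_eq_mul, add_comm]

lemma exists_mem_ne (hd : 1 ≤ d) (v : Space d) : ∃ w ∈ K, w ≠ v := by
  refine Finset.exists_mem_ne ?_ v
  rw [hK.card]; omega

lemma exists_isOutwardNormal (hd : 1 ≤ d) {v : Space d} (hv : v ∈ K) :
    ∃ n, IsOutwardNormal K (oppositeFacet K v) n := by
  obtain ⟨w, hw, hwv⟩ := hK.exists_mem_ne hd v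
  -- The outward normal is the negative normalized gradient of the barycentric coordinate of `v`.
  set g := (InnerProductSpace.toDual ℝ (Space d)).symm (hK.bary v).linear.toContinuousLinearMap
  have hg : ∀ x y : Space d, inner ℝ g (x - y) = hK.bary v x - hK.bary v y := by
    intro x y
    have h := (hK.bary v).linearMap_vsub x y
    rw [vsub_eq_sub, vsub_eq_sub] at h
    rw [InnerProductSpace.toDual_symm_apply]
    exact h
  have hg0 : g ≠ 0 := by
    intro h0
    have := hg v w
    rw [h0, inner_zero_left, hK.bary_self hv, hK.bary_of_ne hw hwv] at this
    norm_num at this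
  have hpos : 0 < ‖g‖ := norm_pos_iff.2 hg0
  refine ⟨-(‖g‖⁻¹ • g), ?_, fun x hx y hy => ?_, fun x hx y hy hyF => ?_⟩
  · rw [norm_neg, norm_smul, norm_inv, norm_norm, inv_mul_cancel₀ hpos.ne']
  · rw [mem_oppositeFacet] at hx hy
    rw [inner_neg_left, real_inner_smul_left, hg, hK.bary_of_ne hx.2 hx.1,
      hK.bary_of_ne hy.2 hy.1]
    simp
  · have hyv : y = v := by by_contra h; exact hyF (mem_oppositeFacet.2 ⟨h, hy⟩)
    rw [mem_oppositeFacet] at hx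
    rw [inner_neg_left, real_inner_smul_left, hg, hK.bary_of_ne hx.2 hx.1, hyv,
      hK.bary_self hv]
    simpa using hpos

/-- The height function above a facet is an affine function of the barycentric coordinate of the
opposite vertex; `η` is the height of the simplex. -/
lemma exists_inner_outwardNormal (hd : 1 ≤ d) {v : Space d} (hv : v ∈ K) :
    ∃ c η : ℝ, ‖outwardNormal K (oppositeFacet K v)‖ = 1 ∧ 0 < η ∧
      ∀ x, inner ℝ (outwardNormal K (oppositeFacet K v)) x = c - η * hK.bary v x := by
  obtain ⟨h1, h2, h3⟩ := Classical.epsilon_spec (hK.exists_isOutwardNormal hd hv)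
  change ‖outwardNormal K (oppositeFacet K v)‖ = 1 at h1
  obtain ⟨w, hw, hwv⟩ := hK.exists_mem_ne hd v
  have hwF : w ∈ oppositeFacet K v := mem_oppositeFacet.2 ⟨hwv, hw⟩
  set n := outwardNormal K (oppositeFacet K v)
  have h3' : inner ℝ n (v - w) < 0 :=
    h3 w hwF v hv (fun h => (mem_oppositeFacet.1 h).1 rfl)
  refine ⟨inner ℝ n w, - inner ℝ n (v - w), h1, by linarith, fun x => ?_⟩
  have h4 : ∀ u ∈ K, inner ℝ n u = inner ℝ n w + hK.bary v u * inner ℝ n (v - w) := by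
    intro u hu
    by_cases huv : u = v
    · rw [huv, hK.bary_self hv, inner_sub_right]; ring
    · have h5 : inner ℝ n (u - w) = 0 := h2 w hwF u (mem_oppositeFacet.2 ⟨huv, hu⟩)
      rw [inner_sub_right] at h5
      rw [hK.bary_of_ne hu huv]
      linarith
  calc inner ℝ n x = ∑ u ∈ K, hK.bary u x * inner ℝ n u := by
        conv_lhs => rw [← hK.sum_bary_smul x]
        simp_rw [inner_sum, inner_smul_right]
    _ = (∑ u ∈ K, hK.bary u x) * inner ℝ n w
          + (∑ u ∈ K, hK.bary u x * hK.bary v u) * inner ℝ n (v - w) := by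
        rw [Finset.sum_mul, Finset.sum_mul, ← Finset.sum_add_distrib]
        refine Finset.sum_congr rfl fun u hu => ?_
        rw [h4 u hu]; ring
    _ = _ := by
        rw [hK.sum_bary, Finset.sum_eq_single v]
        · rw [hK.bary_self hv]; ring
        · intro u hu huv
          rw [hK.bary_of_ne hu huv, mul_zero]
        · exact fun h => absurd hv h

end IsSimplex

/-! ### Fubini on a simplex along an edge -/

lemma isFiniteMeasure_cellMeasure {d : ℕ} (K : Finset (Space d)) :
    IsFiniteMeasure (cellMeasure K) :=
  ⟨by rw [cellMeasure, Measure.restrict_apply_univ]; exact (isCompact_hull K).measure_lt_top⟩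

lemma integrable_cellMeasure {d : ℕ} {E : Type*} [NormedAddCommGroup E] {K : Finset (Space d)}
    {g : Space d → E} (hg : Continuous g) : Integrable g (cellMeasure K) :=
  hg.continuousOn.integrableOn_compact (isCompact_hull K)

namespace IsSimplex
variable {d : ℕ} {K : Finset (Space d)} (hK : IsSimplex K)
include hK

lemma facetMeasure_eq {v : Space d} {n : Space d} {c η : ℝ}
    (h : ∀ x, inner ℝ n x = c - η * hK.bary v x) :
    facetMeasure (oppositeFacet K v) =
      (hyperplaneMeasure n c).restrict (hull (oppositeFacet K v)) := by
  rw [facetMeasure, hyperplaneMeasure, Measure.restrict_restrict (isCompact_hull _).measurableSet,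
    Set.inter_eq_left.2]
  intro x hx
  rw [hK.mem_hull_oppositeFacet_iff] at hx
  rw [hyperplane, Set.mem_ofPred_eq, h, hx.2, mul_zero, sub_zero]

lemma isFiniteMeasure_facetMeasure (hd : 1 ≤ d) {v : Space d} (hv : v ∈ K) :
    IsFiniteMeasure (facetMeasure (oppositeFacet K v)) := by
  obtain ⟨c, η, hn, hη, h⟩ := hK.exists_inner_outwardNormal hd hv
  rw [hK.facetMeasure_eq h]
  exact ⟨by
    rw [Measure.restrict_apply_univ]
    exact hyperplaneMeasure_lt_top hn c (isCompact_hull _)⟩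

lemma integrable_facetMeasure (hd : 1 ≤ d) {v : Space d} (hv : v ∈ K) {g : Space d → ℝ}
    (hg : Continuous g) : Integrable g (facetMeasure (oppositeFacet K v)) := by
  have := hK.isFiniteMeasure_facetMeasure hd hv
  obtain ⟨C, hC⟩ := (isCompact_hull (oppositeFacet K v)).exists_bound_of_continuousOn
    hg.continuousOn
  refine Integrable.of_bound hg.aestronglyMeasurable C ?_
  rw [facetMeasure]
  exact (ae_restrict_mem (isCompact_hull _).measurableSet).mono hC

lemma inner_outwardNormal_edge {v u w n : Space d} {c η : ℝ}
    (h : ∀ x, inner ℝ n x = c - η * hK.bary v x) :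
    inner ℝ n (u - w) = η * (hK.bary v w - hK.bary v u) := by
  rw [inner_sub_right, h, h]; ring

/-- Fubini on a simplex along the edge direction `v - w`: each line in that direction enters
through the facet opposite to `v` and stays inside for the length `bary w`. -/
lemma setIntegral_hull_eq_fiber {v w : Space d} (hv : v ∈ K) (hw : w ∈ K)
    (hvw : v ≠ w) {g : Space d → ℝ} (hg : Continuous g) {c η : ℝ}
    (hn : ‖outwardNormal K (oppositeFacet K v)‖ = 1) (hη : 0 < η)
    (h : ∀ x, inner ℝ (outwardNormal K (oppositeFacet K v)) x = c - η * hK.bary v x) :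
    ∫ x, g x ∂(cellMeasure K) = η * ∫ y, (∫ s in (0 : ℝ)..hK.bary w y, g (y + s • (v - w)))
      ∂(facetMeasure (oppositeFacet K v)) := by
  set n := outwardNormal K (oppositeFacet K v)
  set e := v - w with he
  have hne : inner ℝ n e = -η := by
    rw [hK.inner_outwardNormal_edge h, hK.bary_self hv, hK.bary_of_ne hw hvw.symm]; ring
  have hne0 : inner ℝ n e ≠ 0 := by rw [hne]; linarith
  have hsf := sFinite_hyperplaneMeasure hn c
  have hmap := map_hyperplaneMeasure_prod hn c hne0
  have hψ : Measurable (fun p : Space d × ℝ => p.1 + p.2 • e) := by fun_prop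
  have habs : |(inner ℝ n e)⁻¹| = η⁻¹ := by rw [hne, inv_neg, abs_neg, abs_of_pos (by positivity)]
  rw [habs] at hmap
  set G : Space d → ℝ := (hull K).indicator g with hG
  have hGi : Integrable G volume := by
    rw [hG, integrable_indicator_iff (isCompact_hull K).measurableSet]
    exact hg.continuousOn.integrableOn_compact (isCompact_hull K)
  have hGi' : Integrable G (((hyperplaneMeasure n c).prod (volume : Measure ℝ)).map
      (fun p : Space d × ℝ => p.1 + p.2 • e)) := by
    rw [hmap]; exact hGi.smul_measure ENNReal.ofReal_ne_top
  have hprod : Integrable (fun p : Space d × ℝ => G (p.1 + p.2 • e))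
      ((hyperplaneMeasure n c).prod (volume : Measure ℝ)) :=
    (integrable_map_measure hGi'.1 hψ.aemeasurable).1 hGi'
  have e1 : ∫ x, g x ∂(cellMeasure K) = ∫ x, G x := by
    rw [cellMeasure, hG, integral_indicator (isCompact_hull K).measurableSet]
  have e2 : η⁻¹ * ∫ x, G x = ∫ y, (∫ s : ℝ, G (y + s • e)) ∂(hyperplaneMeasure n c) := by
    rw [← integral_prod _ hprod, ← integral_map hψ.aemeasurable hGi'.1, hmap,
      integral_smul_measure, ENNReal.toReal_ofReal (by positivity), smul_eq_mul]
  have e3 : ∫ y, (∫ s : ℝ, G (y + s • e)) ∂(hyperplaneMeasure n c)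
      = ∫ y, (hull (oppositeFacet K v)).indicator
          (fun y => ∫ s in (0 : ℝ)..hK.bary w y, g (y + s • e)) y ∂(hyperplaneMeasure n c) := by
    refine integral_congr_ae ?_
    have hae : ∀ᵐ y ∂(hyperplaneMeasure n c), y ∈ hyperplane n c :=
      ae_restrict_mem (isClosed_hyperplane n c).measurableSet
    filter_upwards [hae] with y hy
    have hy0 : hK.bary v y = 0 := by
      rw [hyperplane, Set.mem_ofPred_eq, h] at hy
      have : η * hK.bary v y = 0 := by linarith
      exact (mul_eq_zero.1 this).resolve_left hη.ne'
    have hmem : ∀ s : ℝ, y + s • e ∈ hull K ↔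
        y ∈ hull (oppositeFacet K v) ∧ s ∈ Set.Icc 0 (hK.bary w y) := by
      intro s
      rw [hK.mem_hull_oppositeFacet_iff, hK.mem_hull_iff, hK.mem_hull_iff]
      have hb : ∀ u, hK.bary u (y + s • e) = hK.bary u y + s * (hK.bary u v - hK.bary u w) :=
        fun u => hK.bary_add_smul u y v w s
      have hbv : hK.bary v (y + s • e) = s := by
        rw [hb, hy0, hK.bary_self hv, hK.bary_of_ne hw hvw.symm]; ring
      have hbw : hK.bary w (y + s • e) = hK.bary w y - s := by
        rw [hb, hK.bary_self hw, hK.bary_of_ne hv hvw]; ring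
      have hbu : ∀ u ∈ K, u ≠ v → u ≠ w → hK.bary u (y + s • e) = hK.bary u y := by
        intro u hu huv huw
        rw [hb, hK.bary_of_ne hv huv.symm, hK.bary_of_ne hw huw.symm]; ring
      constructor
      · intro H
        have H1 := H v hv
        have H2 := H w hw
        rw [hbv] at H1
        rw [hbw] at H2
        refine ⟨⟨fun u hu => ?_, hy0⟩, H1, by linarith⟩
        by_cases huv : u = v
        · rw [huv, hy0]
        by_cases huw : u = w
        · rw [huw]; linarith
        rw [← hbu u hu huv huw]; exact H u hu
      · rintro ⟨⟨H1, -⟩, H2, H3⟩ u hu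
        by_cases huv : u = v
        · rw [huv, hbv]; exact H2
        by_cases huw : u = w
        · rw [huw, hbw]; linarith
        rw [hbu u hu huv huw]; exact H1 u hu
    by_cases hyF : y ∈ hull (oppositeFacet K v)
    · have hbw : 0 ≤ hK.bary w y := by
        rw [hK.mem_hull_oppositeFacet_iff, hK.mem_hull_iff] at hyF
        exact hyF.1 w hw
      rw [Set.indicator_of_mem hyF, intervalIntegral.integral_of_le hbw,
        ← integral_Icc_eq_integral_Ioc, ← integral_indicator measurableSet_Icc]
      refine integral_congr_ae (Eventually.of_forall fun s => ?_)
      by_cases hs : s ∈ Set.Icc 0 (hK.bary w y)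
      all_goals beta_reduce
      · rw [Set.indicator_of_mem hs, hG, Set.indicator_of_mem ((hmem s).2 ⟨hyF, hs⟩)]
      · rw [Set.indicator_of_notMem hs, hG, Set.indicator_of_notMem]
        exact fun hh => hs ((hmem s).1 hh).2
    · rw [Set.indicator_of_notMem hyF]
      refine integral_eq_zero_of_ae (Eventually.of_forall fun s => ?_)
      beta_reduce
      rw [hG, Set.indicator_of_notMem]
      · rfl
      · exact fun hh => hyF ((hmem s).1 hh).1
  rw [hK.facetMeasure_eq h, ← integral_indicator (isCompact_hull _).measurableSet, ← e3, ← e2, e1,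
    ← mul_assoc, mul_inv_cancel₀ hη.ne', one_mul]

/-- Integrating over a facet a function pulled back from another one along their common
complementary edge. -/
lemma integral_facet_shift {v w : Space d} (hv : v ∈ K) (hw : w ∈ K)
    (hvw : v ≠ w) {g : Space d → ℝ} (hg : Continuous g) {n n' : Space d} {c η c' η' : ℝ}
    (hn : ‖n‖ = 1) (hη : 0 < η) (h : ∀ x, inner ℝ n x = c - η * hK.bary v x)
    (hn' : ‖n'‖ = 1) (hη' : 0 < η') (h' : ∀ x, inner ℝ n' x = c' - η' * hK.bary w x) :
    η * ∫ y, g (y + hK.bary w y • (v - w)) ∂(facetMeasure (oppositeFacet K v)) =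
      η' * ∫ y, g y ∂(facetMeasure (oppositeFacet K w)) := by
  set e := v - w with he
  have hne : inner ℝ n e = -η := by
    rw [hK.inner_outwardNormal_edge h, hK.bary_self hv, hK.bary_of_ne hw hvw.symm]; ring
  have hne' : inner ℝ n' e = η' := by
    rw [hK.inner_outwardNormal_edge h', hK.bary_self hw, hK.bary_of_ne hv hvw]; ring
  have hB : ∀ y, obliqueProj n' c' e y = y + hK.bary w y • e := by
    intro y
    rw [obliqueProj, h', hne']
    congr 2
    field_simp
    ring
  have hmap := map_obliqueProj_hyperplaneMeasure hn hn' c c' (e := e)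
    (by rw [hne]; linarith) (by rw [hne']; linarith)
  rw [hne, hne', abs_neg, abs_of_pos hη, abs_of_pos hη'] at hmap
  set G := (hull (oppositeFacet K w)).indicator g with hG
  have hGm : StronglyMeasurable G :=
    hg.stronglyMeasurable.indicator (isCompact_hull _).measurableSet
  have hint := congrArg (fun μ => ∫ x, G x ∂μ) hmap
  beta_reduce at hint
  rw [integral_smul_measure, integral_smul_measure, ENNReal.toReal_ofReal hη.le,
    ENNReal.toReal_ofReal hη'.le, integral_map (by fun_prop) hGm.aestronglyMeasurable,
    smul_eq_mul, smul_eq_mul] at hint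
  rw [hK.facetMeasure_eq h', ← integral_indicator (isCompact_hull _).measurableSet, ← hG, ← hint,
    hK.facetMeasure_eq h, ← integral_indicator (isCompact_hull _).measurableSet]
  congr 1
  refine integral_congr_ae ?_
  have hae : ∀ᵐ y ∂(hyperplaneMeasure n c), y ∈ hyperplane n c :=
    ae_restrict_mem (isClosed_hyperplane n c).measurableSet
  filter_upwards [hae] with y hy
  have hy0 : hK.bary v y = 0 := by
    rw [hyperplane, Set.mem_ofPred_eq, h] at hy
    have : η * hK.bary v y = 0 := by linarith
    exact (mul_eq_zero.1 this).resolve_left hη.ne'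
  rw [hB]
  have hiff : y + hK.bary w y • e ∈ hull (oppositeFacet K w) ↔ y ∈ hull (oppositeFacet K v) := by
    rw [hK.mem_hull_oppositeFacet_iff, hK.mem_hull_oppositeFacet_iff, hK.mem_hull_iff,
      hK.mem_hull_iff]
    have hb : ∀ u, hK.bary u (y + hK.bary w y • e)
        = hK.bary u y + hK.bary w y * (hK.bary u v - hK.bary u w) :=
      fun u => hK.bary_add_smul u y v w _
    have hbv : hK.bary v (y + hK.bary w y • e) = hK.bary w y := by
      rw [hb, hy0, hK.bary_self hv, hK.bary_of_ne hw hvw.symm]; ring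
    have hbw : hK.bary w (y + hK.bary w y • e) = 0 := by
      rw [hb, hK.bary_self hw, hK.bary_of_ne hv hvw]; ring
    have hbu : ∀ u ∈ K, u ≠ v → u ≠ w → hK.bary u (y + hK.bary w y • e) = hK.bary u y := by
      intro u hu huv huw
      rw [hb, hK.bary_of_ne hv huv.symm, hK.bary_of_ne hw huw.symm]; ring
    refine and_congr ⟨fun H u hu => ?_, fun H u hu => ?_⟩ (by simp [hbw, hy0])
    · by_cases huv : u = v
      · rw [huv, hy0]
      by_cases huw : u = w
      · rw [huw, ← hbv]; exact H v hv
      rw [← hbu u hu huv huw]; exact H u hu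
    · by_cases huv : u = v
      · rw [huv, hbv]; exact H w hw
      by_cases huw : u = w
      · rw [huw, hbw]
      rw [hbu u hu huv huw]; exact H u hu
  by_cases hyF : y ∈ hull (oppositeFacet K v)
  · rw [Set.indicator_of_mem hyF, hG, Set.indicator_of_mem (hiff.2 hyF)]
  · rw [Set.indicator_of_notMem hyF, hG, Set.indicator_of_notMem (fun hh => hyF (hiff.1 hh))]

end IsSimplex

/-! ### The divergence theorem on a simplex -/

namespace IsSimplex
variable {d : ℕ} {K : Finset (Space d)} (hK : IsSimplex K)
include hK

lemma integral_fderiv_edge (hd : 1 ≤ d) {v w : Space d} (hv : v ∈ K) (hw : w ∈ K) (hvw : v ≠ w)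
    {q : Space d → ℝ} (hq : ContDiff ℝ 1 q) :
    ∫ x, fderiv ℝ q x (v - w) ∂(cellMeasure K) =
      ∑ u ∈ K, inner ℝ (outwardNormal K (oppositeFacet K u)) (v - w) *
        ∫ x, q x ∂(facetMeasure (oppositeFacet K u)) := by
  obtain ⟨c, η, hn, hη, h⟩ := hK.exists_inner_outwardNormal hd hv
  obtain ⟨c', η', hn', hη', h'⟩ := hK.exists_inner_outwardNormal hd hw
  have hq' : Continuous fun x => fderiv ℝ q x (v - w) :=
    (hq.continuous_fderiv one_ne_zero).clm_apply continuous_const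
  rw [hK.setIntegral_hull_eq_fiber hv hw hvw hq' hn hη h]
  have hftc : ∀ y, ∫ s in (0 : ℝ)..hK.bary w y, fderiv ℝ q (y + s • (v - w)) (v - w)
      = q (y + hK.bary w y • (v - w)) - q y := by
    intro y
    have hderiv : ∀ s ∈ Set.uIcc 0 (hK.bary w y), HasDerivAt (fun s : ℝ => q (y + s • (v - w)))
        (fderiv ℝ q (y + s • (v - w)) (v - w)) s := by
      intro s _
      have h1 : HasDerivAt (fun s : ℝ => y + s • (v - w)) (v - w) s := by
        simpa using ((hasDerivAt_id s).smul_const (v - w)).const_add y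
      exact ((hq.differentiable one_ne_zero) _).hasFDerivAt.comp_hasDerivAt s h1
    rw [intervalIntegral.integral_eq_sub_of_hasDerivAt hderiv]
    · simp
    · exact (hq'.comp (by fun_prop : Continuous fun s : ℝ => y + s • (v - w))).intervalIntegrable
        _ _
  simp_rw [hftc]
  have hqc := hq.continuous
  -- The shift by the fiber length carries the facet opposite to `v` onto the one opposite to `w`.
  rw [integral_sub (hK.integrable_facetMeasure hd hv (by fun_prop))
    (hK.integrable_facetMeasure hd hv hqc), mul_sub,
    hK.integral_facet_shift hv hw hvw hqc hn hη h hn' hη' h']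
  classical
  rw [← Finset.sum_subset (s₁ := {v, w})]
  · rw [Finset.sum_pair hvw, hK.inner_outwardNormal_edge h, hK.inner_outwardNormal_edge h',
      hK.bary_self hv, hK.bary_self hw, hK.bary_of_ne hv hvw, hK.bary_of_ne hw hvw.symm]
    ring
  · intro u hu
    rcases Finset.mem_insert.1 hu with rfl | hu
    · exact hv
    · rw [Finset.mem_singleton.1 hu]; exact hw
  · intro u hu hu'
    rw [Finset.mem_insert, Finset.mem_singleton, not_or] at hu'
    obtain ⟨_, _, _, _, h''⟩ := hK.exists_inner_outwardNormal hd hu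
    rw [hK.inner_outwardNormal_edge h'', hK.bary_of_ne hv (Ne.symm hu'.1),
      hK.bary_of_ne hw (Ne.symm hu'.2)]
    ring

lemma span_edges (w : Space d) :
    Submodule.span ℝ {e : Space d | ∃ v ∈ K, e = v - w} = ⊤ := by
  rw [eq_top_iff]
  rintro x -
  have h : x = ∑ v ∈ K, hK.bary v (x + w) • (v - w) := by
    simp_rw [smul_sub]
    rw [Finset.sum_sub_distrib, hK.sum_bary_smul, ← Finset.sum_smul, hK.sum_bary, one_smul]
    abel
  rw [h]
  exact Submodule.sum_mem _ fun v hv => Submodule.smul_mem _ _ (Submodule.subset_span ⟨v, hv, rfl⟩)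

/-- The divergence theorem on a simplex, for the vector field `q • e` with constant direction. Both
sides are linear in `e`, so that it is enough to treat the edge directions. -/
lemma integral_fderiv_eq_sum_facets (hd : 1 ≤ d) {q : Space d → ℝ} (hq : ContDiff ℝ 1 q)
    (e : Space d) :
    ∫ x, fderiv ℝ q x e ∂(cellMeasure K) =
      ∑ u ∈ K, inner ℝ (outwardNormal K (oppositeFacet K u)) e *
        ∫ x, q x ∂(facetMeasure (oppositeFacet K u)) := by
  obtain ⟨w, hw⟩ : K.Nonempty := Finset.card_pos.1 (by rw [hK.card]; omega)
  have hint : ∀ e : Space d, Integrable (fun x => fderiv ℝ q x e) (cellMeasure K) := fun e =>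
    integrable_cellMeasure ((hq.continuous_fderiv one_ne_zero).clm_apply continuous_const)
  have he : e ∈ Submodule.span ℝ {e : Space d | ∃ v ∈ K, e = v - w} := by
    rw [hK.span_edges w]; trivial
  induction he using Submodule.span_induction with
  | mem e he =>
    obtain ⟨v, hv, rfl⟩ := he
    by_cases hvw : v = w
    · simp [hvw]
    · exact hK.integral_fderiv_edge hd hv hw hvw hq
  | zero => simp
  | add e e' _ _ h h' =>
    simp_rw [map_add, inner_add_right, add_mul]
    rw [integral_add (hint e) (hint e'), h, h', Finset.sum_add_distrib]
  | smul a e _ h =>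
    simp_rw [map_smul, inner_smul_right, smul_eq_mul]
    rw [integral_const_mul, h, Finset.mul_sum]
    exact Finset.sum_congr rfl fun u _ => by ring

/-- The divergence theorem on a simplex, for a vector field given by its components. -/
lemma integral_div_eq_sum_facets (hd : 1 ≤ d) {V : Fin d → Space d → ℝ}
    (hV : ∀ i, ContDiff ℝ 1 (V i)) :
    ∫ x, ∑ i, fderiv ℝ (V i) x (EuclideanSpace.single i 1) ∂(cellMeasure K) =
      ∑ u ∈ K, ∫ x, inner ℝ (WithLp.toLp 2 fun i => V i x : Space d)
        (outwardNormal K (oppositeFacet K u)) ∂(facetMeasure (oppositeFacet K u)) := by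
  rw [integral_finsetSum _ fun i _ => integrable_cellMeasure
    (((hV i).continuous_fderiv one_ne_zero).clm_apply continuous_const)]
  simp_rw [fun i => hK.integral_fderiv_eq_sum_facets hd (hV i) (EuclideanSpace.single i (1 : ℝ))]
  rw [Finset.sum_comm]
  refine Finset.sum_congr rfl fun u hu => ?_
  simp_rw [PiLp.inner_apply, ← integral_const_mul]
  rw [integral_finsetSum]
  · refine Finset.sum_congr rfl fun i _ => integral_congr_ae (Eventually.of_forall fun x => ?_)
    simp [mul_comm]
  · intro i _
    refine hK.integrable_facetMeasure hd hu ?_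
    have := (hV i).continuous
    simp only [RCLike.inner_apply, conj_trivial]
    fun_prop

lemma bary_le_one {x v : Space d} (hx : x ∈ hull K) (hv : v ∈ K) : hK.bary v x ≤ 1 := by
  rw [← hK.sum_bary x]
  exact Finset.single_le_sum (fun u hu => hK.mem_hull_iff.1 hx u hu) hv

/-- The affine retraction of `K` onto the facet opposite to `v` which sends `v` to the vertex `w`
does not increase `L²` norms by more than the square root of the mesh size. -/
lemma integral_comp_retraction_le (hd : 1 ≤ d) {v w : Space d} (hv : v ∈ K) (hw : w ∈ K)
    (hvw : v ≠ w) {g : Space d → ℝ} (hg : Continuous g) (hg0 : ∀ x, 0 ≤ g x) :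
    ∫ x, g (x - hK.bary v x • (v - w)) ∂(cellMeasure K) ≤
      meshSize K * ∫ y, g y ∂(facetMeasure (oppositeFacet K v)) := by
  obtain ⟨c, η, hn, hη, h⟩ := hK.exists_inner_outwardNormal hd hv
  have hηle : η ≤ meshSize K := by
    have h1 := hK.inner_outwardNormal_edge h (u := v) (w := w)
    rw [hK.bary_self hv, hK.bary_of_ne hw hvw.symm] at h1
    have h2 := abs_real_inner_le_norm (outwardNormal K (oppositeFacet K v)) (v - w)
    rw [h1, hn, one_mul, zero_sub, mul_neg, mul_one, abs_neg, abs_of_pos hη, ← dist_eq_norm] at h2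
    exact h2.trans (Metric.dist_le_diam_of_mem (isCompact_hull K).isBounded
      (subset_convexHull ℝ _ hv) (subset_convexHull ℝ _ hw))
  have hI : 0 ≤ ∫ y, g y ∂(facetMeasure (oppositeFacet K v)) := integral_nonneg hg0
  rw [hK.setIntegral_hull_eq_fiber (g := fun x => g (x - hK.bary v x • (v - w))) hv hw hvw
    (by fun_prop) hn hη h]
  refine le_trans ?_ (mul_le_mul_of_nonneg_right hηle hI)
  refine mul_le_mul_of_nonneg_left ?_ hη.le
  have hae : ∀ᵐ y ∂(facetMeasure (oppositeFacet K v)), y ∈ hull (oppositeFacet K v) :=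
    ae_restrict_mem (isCompact_hull _).measurableSet
  have heq : ∀ᵐ y ∂(facetMeasure (oppositeFacet K v)),
      (∫ s in (0 : ℝ)..hK.bary w y,
        g (y + s • (v - w) - hK.bary v (y + s • (v - w)) • (v - w))) = hK.bary w y * g y := by
    filter_upwards [hae] with y hy
    have hy0 := (hK.mem_hull_oppositeFacet_iff.1 hy).2
    have : ∀ s : ℝ, y + s • (v - w) - hK.bary v (y + s • (v - w)) • (v - w) = y := by
      intro s
      rw [hK.bary_add_smul, hy0, hK.bary_self hv, hK.bary_of_ne hw hvw.symm]
      module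
    simp [this]
  rw [integral_congr_ae heq]
  refine integral_mono_ae (hK.integrable_facetMeasure hd hv (by fun_prop))
    (hK.integrable_facetMeasure hd hv hg) ?_
  filter_upwards [hae] with y hy
  exact mul_le_of_le_one_left (hg0 y)
    (hK.bary_le_one (hK.mem_hull_oppositeFacet_iff.1 hy).1 hw)

end IsSimplex

/-! ### `L²` norms and the trace inequality -/

section L2
variable {α E : Type*} [MeasurableSpace α] {μ : Measure α} [NormedAddCommGroup E]

/-- The `L²` norm as a real number. -/
def l2norm (μ : Measure α) (f : α → E) : ℝ := (eLpNorm f 2 μ).toReal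

lemma l2norm_nonneg (μ : Measure α) (f : α → E) : 0 ≤ l2norm μ f := ENNReal.toReal_nonneg

lemma l2norm_sub_comm (f g : α → E) :
    l2norm μ (fun x => f x - g x) = l2norm μ (fun x => g x - f x) := by
  rw [l2norm, l2norm]
  congr 1
  exact eLpNorm_sub_comm f g 2 μ

lemma l2norm_add_le {f g : α → E} (hf : MemLp f 2 μ) (hg : MemLp g 2 μ) :
    l2norm μ (fun x => f x + g x) ≤ l2norm μ f + l2norm μ g := by
  rw [l2norm, l2norm, l2norm, ← ENNReal.toReal_add hf.2.ne hg.2.ne]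
  exact ENNReal.toReal_mono (ENNReal.add_ne_top.2 ⟨hf.2.ne, hg.2.ne⟩)
    (eLpNorm_add_le hf.1 hg.1 one_le_two)

lemma l2norm_sub_le {f g h : α → E} (hf : MemLp f 2 μ) (hg : MemLp g 2 μ) (hh : MemLp h 2 μ) :
    l2norm μ (fun x => f x - h x) ≤
      l2norm μ (fun x => f x - g x) + l2norm μ (fun x => g x - h x) := by
  refine le_trans (le_of_eq ?_) (l2norm_add_le (f := fun x => f x - g x)
    (g := fun x => g x - h x) (hf.sub hg) (hg.sub hh))
  simp

lemma l2norm_le_mul {F : Type*} [NormedAddCommGroup F] {f : α → E}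
    {g : α → F} (hg : MemLp g 2 μ) {C : ℝ} (hC : 0 ≤ C) (h : ∀ᵐ x ∂μ, ‖f x‖ ≤ C * ‖g x‖) :
    l2norm μ f ≤ C * l2norm μ g := by
  have h1 := eLpNorm_le_mul_eLpNorm_of_ae_le_mul h 2
  rw [l2norm, l2norm]
  refine (ENNReal.toReal_mono (ENNReal.mul_ne_top ENNReal.ofReal_ne_top hg.2.ne) h1).trans_eq ?_
  rw [ENNReal.toReal_mul, ENNReal.toReal_ofReal hC]

lemma tendsto_l2norm {f : ℕ → α → E} (h : Tendsto (fun n => eLpNorm (f n) 2 μ) atTop (𝓝 0)) :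
    Tendsto (fun n => l2norm μ (f n)) atTop (𝓝 0) := by
  have := (ENNReal.tendsto_toReal ENNReal.zero_ne_top).comp h
  simpa [l2norm, Function.comp_def] using this

lemma memLp_two_of_continuous {d : ℕ} {E : Type*} [NormedAddCommGroup E] {S : Set (Space d)}
    (hS : IsCompact S) {μ : Measure (Space d)} [IsFiniteMeasure (μ.restrict S)]
    {f : Space d → E} (hf : Continuous f) : MemLp f 2 (μ.restrict S) := by
  obtain ⟨C, hC⟩ := hS.exists_bound_of_continuousOn hf.continuousOn
  exact MemLp.of_bound hf.aestronglyMeasurable C ((ae_restrict_mem hS.measurableSet).mono hC)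

variable [InnerProductSpace ℝ E]

lemma integral_inner_toLp {f g : α → E} (hf : MemLp f 2 μ) (hg : MemLp g 2 μ) :
    inner ℝ (hf.toLp f) (hg.toLp g) = ∫ x, inner ℝ (f x) (g x) ∂μ := by
  rw [L2.inner_def]
  refine integral_congr_ae ?_
  filter_upwards [hf.coeFn_toLp, hg.coeFn_toLp] with x h1 h2
  rw [h1, h2]

lemma integrable_inner_of_memLp {f g : α → E} (hf : MemLp f 2 μ) (hg : MemLp g 2 μ) :
    Integrable (fun x => inner ℝ (f x) (g x)) μ := by
  refine (L2.integrable_inner (𝕜 := ℝ) (hf.toLp f) (hg.toLp g)).congr ?_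
  filter_upwards [hf.coeFn_toLp, hg.coeFn_toLp] with x h1 h2
  rw [h1, h2]

lemma l2norm_sq {f : α → E} (hf : MemLp f 2 μ) : l2norm μ f ^ 2 = ∫ x, inner ℝ (f x) (f x) ∂μ := by
  rw [← integral_inner_toLp hf hf, real_inner_self_eq_norm_sq, Lp.norm_toLp, l2norm]

lemma l2norm_sq_real {f : α → ℝ} (hf : MemLp f 2 μ) : l2norm μ f ^ 2 = ∫ x, f x ^ 2 ∂μ := by
  rw [l2norm_sq hf]
  simp

lemma abs_integral_inner_le {f g : α → E} (hf : MemLp f 2 μ) (hg : MemLp g 2 μ) :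
    |∫ x, inner ℝ (f x) (g x) ∂μ| ≤ l2norm μ f * l2norm μ g := by
  rw [← integral_inner_toLp hf hg]
  refine (abs_real_inner_le_norm _ _).trans_eq ?_
  rw [Lp.norm_toLp, Lp.norm_toLp, l2norm, l2norm]

lemma abs_integral_mul_le {f g : α → ℝ} (hf : MemLp f 2 μ) (hg : MemLp g 2 μ) :
    |∫ x, f x * g x ∂μ| ≤ l2norm μ f * l2norm μ g := by
  simpa [mul_comm] using abs_integral_inner_le hf hg

end L2

lemma memLp_cellMeasure {d : ℕ} {E : Type*} [NormedAddCommGroup E] (K : Finset (Space d))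
    {f : Space d → E} (hf : Continuous f) : MemLp f 2 (cellMeasure K) := by
  have : IsFiniteMeasure (volume.restrict (hull K)) := isFiniteMeasure_cellMeasure K
  exact memLp_two_of_continuous (isCompact_hull K) hf

lemma IsSimplex.memLp_facetMeasure {d : ℕ} {K : Finset (Space d)} (hK : IsSimplex K)
    (hd : 1 ≤ d) {v : Space d} (hv : v ∈ K) {E : Type*} [NormedAddCommGroup E]
    {f : Space d → E} (hf : Continuous f) : MemLp f 2 (facetMeasure (oppositeFacet K v)) := by
  have := hK.isFiniteMeasure_facetMeasure hd hv
  rw [facetMeasure] at this ⊢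
  exact memLp_two_of_continuous (isCompact_hull _) hf

lemma continuous_gradient {d : ℕ} {φ : Space d → ℝ} (hφ : ContDiff ℝ 1 φ) :
    Continuous (gradient φ) :=
  (InnerProductSpace.toDual ℝ (Space d)).symm.continuous.comp (hφ.continuous_fderiv one_ne_zero)

lemma inner_gradient {d : ℕ} (φ : Space d → ℝ) (x y : Space d) :
    inner ℝ (gradient φ x) y = fderiv ℝ φ x y := by
  rw [gradient, InnerProductSpace.toDual_symm_apply]

lemma gradient_sub {d : ℕ} {φ ψ : Space d → ℝ} (hφ : ContDiff ℝ 1 φ) (hψ : ContDiff ℝ 1 ψ)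
    (x : Space d) : gradient (fun y => φ y - ψ y) x = gradient φ x - gradient ψ x := by
  rw [gradient, gradient, gradient, ← map_sub]
  congr 1
  exact fderiv_sub (hφ.differentiable one_ne_zero x) (hψ.differentiable one_ne_zero x)

lemma inner_eq_sum_single {d : ℕ} (L : Space d →L[ℝ] ℝ) (y : Space d) :
    ∑ i, L (EuclideanSpace.single i 1) * y i = L y := by
  conv_rhs => rw [← (EuclideanSpace.basisFun (Fin d) ℝ).sum_repr y]
  rw [map_sum]
  refine Finset.sum_congr rfl fun i _ => ?_
  simp [mul_comm]

/-- The multiplicative trace inequality on a simplex, from the divergence theorem for the field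
`x ↦ φ(x)² (x - v)`, which is tangential to all the facets but the one opposite to `v`. -/
lemma IsSimplex.exists_trace_inequality {d : ℕ} {K : Finset (Space d)} (hK : IsSimplex K)
    (hd : 1 ≤ d) {v : Space d} (hv : v ∈ K) :
    ∃ C : ℝ, 0 ≤ C ∧ ∀ φ : Space d → ℝ, ContDiff ℝ 1 φ →
      l2norm (facetMeasure (oppositeFacet K v)) φ ^ 2 ≤
        C * (l2norm (cellMeasure K) φ ^ 2 +
          l2norm (cellMeasure K) φ * l2norm (cellMeasure K) (gradient φ)) := by
  obtain ⟨c, η, hn, hη, h⟩ := hK.exists_inner_outwardNormal hd hv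
  have hh0 : 0 ≤ meshSize K := Metric.diam_nonneg
  refine ⟨η⁻¹ * (d + 2 * meshSize K), by positivity, fun φ hφ => ?_⟩
  have hφc := hφ.continuous
  have hgc := continuous_gradient hφ
  have hV : ∀ i : Fin d, ContDiff ℝ 1 fun x : Space d => φ x ^ 2 * (x i - v i) := by
    intro i
    have : ContDiff ℝ 1 fun x : Space d => x i :=
      (EuclideanSpace.proj (𝕜 := ℝ) i).contDiff
    fun_prop
  have hdiv := hK.integral_div_eq_sum_facets hd hV
  have hL : ∀ x : Space d, ∑ i, fderiv ℝ (fun x : Space d => φ x ^ 2 * (x i - v i)) x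
      (EuclideanSpace.single i 1) = d * φ x ^ 2 + 2 * inner ℝ (φ x • (x - v)) (gradient φ x) := by
    intro x
    have h1 : ∀ i : Fin d, fderiv ℝ (fun x : Space d => φ x ^ 2 * (x i - v i)) x
        (EuclideanSpace.single i 1) = φ x ^ 2 + 2 * φ x *
          (fderiv ℝ φ x (EuclideanSpace.single i 1) * (x - v) i) := by
      intro i
      have h2 : HasFDerivAt (fun x : Space d => x i - v i) (EuclideanSpace.proj (𝕜 := ℝ) i) x :=
        (EuclideanSpace.proj (𝕜 := ℝ) i).hasFDerivAt.sub_const _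
      have h3 := ((hφ.differentiable one_ne_zero x).hasFDerivAt.pow 2).mul h2
      have h4 := h3.fderiv
      refine (congrArg (fun L => L (EuclideanSpace.single i 1)) h4).trans ?_
      simp
      ring
    simp_rw [h1]
    rw [Finset.sum_add_distrib, ← Finset.mul_sum, inner_eq_sum_single, real_inner_comm,
      inner_smul_right, inner_gradient]
    simp
    ring
  have hR : ∀ u ∈ K, ∀ x ∈ hull (oppositeFacet K u),
      inner ℝ (WithLp.toLp 2 fun i => φ x ^ 2 * (x i - v i) : Space d)
        (outwardNormal K (oppositeFacet K u)) = if u = v then η * φ x ^ 2 else 0 := by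
    intro u hu x hx
    have h1 : (WithLp.toLp 2 fun i => φ x ^ 2 * (x i - v i) : Space d) = φ x ^ 2 • (x - v) := by
      ext i; simp
    have hx0 := (hK.mem_hull_oppositeFacet_iff.1 hx).2
    rw [h1, real_inner_comm, inner_smul_right]
    split_ifs with huv
    · subst huv
      rw [hK.inner_outwardNormal_edge h, hx0, hK.bary_self hv]
      ring
    · obtain ⟨_, _, _, _, h'⟩ := hK.exists_inner_outwardNormal hd hu
      rw [hK.inner_outwardNormal_edge h', hx0, hK.bary_of_ne hv (Ne.symm huv)]
      ring
  simp_rw [hL] at hdiv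
  rw [Finset.sum_eq_single v] at hdiv
  rotate_left
  · intro u hu huv
    rw [facetMeasure, setIntegral_congr_fun (isCompact_hull _).measurableSet (hR u hu)]
    simp [huv]
  · exact fun h => absurd hv h
  have hRv : ∫ x, inner ℝ (WithLp.toLp 2 fun i => φ x ^ 2 * (x i - v i) : Space d)
      (outwardNormal K (oppositeFacet K v)) ∂(facetMeasure (oppositeFacet K v))
      = η * l2norm (facetMeasure (oppositeFacet K v)) φ ^ 2 := by
    rw [l2norm_sq_real (hK.memLp_facetMeasure hd hv hφc), ← integral_const_mul, facetMeasure,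
      setIntegral_congr_fun (isCompact_hull _).measurableSet (hR v hv)]
    simp
  have hm1 := memLp_cellMeasure K hφc
  have hm2 := memLp_cellMeasure K hgc
  have hc3 : Continuous fun x => φ x • (x - v) := by fun_prop
  have hm3 := memLp_cellMeasure K hc3
  rw [hRv, integral_add (integrable_cellMeasure (by fun_prop))
    (integrable_cellMeasure (by fun_prop)), integral_const_mul, integral_const_mul,
    ← l2norm_sq_real hm1] at hdiv
  have hle : l2norm (cellMeasure K) (fun x => φ x • (x - v)) ≤
      meshSize K * l2norm (cellMeasure K) φ := by
    refine l2norm_le_mul hm1 hh0 ?_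
    filter_upwards [ae_restrict_mem (isCompact_hull K).measurableSet] with x hx
    rw [norm_smul, mul_comm, ← dist_eq_norm]
    gcongr
    exact Metric.dist_le_diam_of_mem (isCompact_hull K).isBounded hx (subset_convexHull ℝ _ hv)
  have hcs := (le_abs_self _).trans (abs_integral_inner_le hm3 hm2)
  have hA := l2norm_nonneg (cellMeasure K) φ
  have hB := l2norm_nonneg (cellMeasure K) (gradient φ)
  rw [mul_assoc, inv_mul_eq_div, le_div_iff₀ hη, mul_comm _ η, ← hdiv]
  have h5 := hcs.trans (mul_le_mul_of_nonneg_right hle hB)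
  have hd0 : (0 : ℝ) ≤ d := Nat.cast_nonneg d
  nlinarith [mul_nonneg hd0 (mul_nonneg hA hB),
    mul_nonneg hh0 (sq_nonneg (l2norm (cellMeasure K) φ))]

/-! ### Existence and uniqueness of traces -/

lemma cellMeasure_eq_restrict_interior {d : ℕ} (K : Finset (Space d)) :
    cellMeasure K = volume.restrict (interior (hull K)) :=
  Measure.restrict_congr_set
    (interior_ae_eq_of_null_frontier ((convex_convexHull ℝ _).addHaar_frontier volume)).symm

lemma cellMeasure_le {d : ℕ} {K : Finset (Space d)} {Ω : Set (Space d)}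
    (h : interior (hull K) ⊆ Ω) : cellMeasure K ≤ volume.restrict Ω := by
  rw [cellMeasure_eq_restrict_interior]
  exact Measure.restrict_mono h le_rfl

/-- If `C¹` functions are `L²`-close on `K` and have bounded gradients, their traces are
`L²`-close. -/
lemma IsSimplex.tendsto_l2norm_facet {d : ℕ} {K : Finset (Space d)} (hK : IsSimplex K)
    (hd : 1 ≤ d) {v : Space d} (hv : v ∈ K) {ι : Type*} {l : Filter ι} {φ : ι → Space d → ℝ}
    (hφ : ∀ n, ContDiff ℝ 1 (φ n)) {a b : ι → ℝ} {B : ℝ}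
    (ha : Tendsto a l (𝓝 0)) (hb : Tendsto b l (𝓝 B))
    (hφa : ∀ n, l2norm (cellMeasure K) (φ n) ≤ a n)
    (hφb : ∀ n, l2norm (cellMeasure K) (gradient (φ n)) ≤ b n) :
    Tendsto (fun n => l2norm (facetMeasure (oppositeFacet K v)) (φ n)) l (𝓝 0) := by
  obtain ⟨C, hC, htr⟩ := hK.exists_trace_inequality hd hv
  have hlim : Tendsto (fun n => Real.sqrt (C * (a n ^ 2 + a n * b n))) l (𝓝 0) := by
    have := ((((ha.pow 2).add (ha.mul hb)).const_mul C).sqrt)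
    simpa using this
  refine squeeze_zero (fun n => l2norm_nonneg _ _) (fun n => ?_) hlim
  refine Real.le_sqrt_of_sq_le ((htr _ (hφ n)).trans ?_)
  have h1 := l2norm_nonneg (cellMeasure K) (φ n)
  have h2 := l2norm_nonneg (cellMeasure K) (gradient (φ n))
  have h3 := h1.trans (hφa n)
  gcongr
  exacts [hφa n, hφa n, hφb n]

lemma IsFacetTrace.ae_eq {d : ℕ} {K : Finset (Space d)} (hK : IsSimplex K)
    (hd : 1 ≤ d) {v : Space d} (hv : v ∈ K) {f g g' : Space d → ℝ}
    (hf : MemLp f 2 (cellMeasure K)) (h : IsFacetTrace K (oppositeFacet K v) f g)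
    (h' : IsFacetTrace K (oppositeFacet K v) f g') :
    g =ᵐ[facetMeasure (oppositeFacet K v)] g' := by
  obtain ⟨hg, φ, G, hφ, hG, h1, h2, h3⟩ := h
  obtain ⟨hg', ψ, G', hψ, hG', h1', h2', h3'⟩ := h'
  have hφ1 : ∀ n, ContDiff ℝ 1 (φ n) := fun n => (hφ n).of_le (by exact_mod_cast le_top)
  have hψ1 : ∀ n, ContDiff ℝ 1 (ψ n) := fun n => (hψ n).of_le (by exact_mod_cast le_top)
  have mφ := fun n => memLp_cellMeasure K (hφ1 n).continuous
  have mψ := fun n => memLp_cellMeasure K (hψ1 n).continuous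
  have mgφ := fun n => memLp_cellMeasure K (continuous_gradient (hφ1 n))
  have mgψ := fun n => memLp_cellMeasure K (continuous_gradient (hψ1 n))
  have key := hK.tendsto_l2norm_facet hd hv (l := atTop) (φ := fun n x => φ n x - ψ n x)
    (a := fun n => l2norm (cellMeasure K) (fun x => φ n x - f x) +
      l2norm (cellMeasure K) (fun x => ψ n x - f x))
    (b := fun n => (l2norm (cellMeasure K) (fun x => gradient (φ n) x - G x) +
      l2norm (cellMeasure K) (fun x => G x - G' x)) +
      l2norm (cellMeasure K) (fun x => gradient (ψ n) x - G' x))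
    (B := (0 + l2norm (cellMeasure K) (fun x => G x - G' x)) + 0)
    (fun n => (hφ1 n).sub (hψ1 n))
    (by simpa using (tendsto_l2norm h1).add (tendsto_l2norm h1'))
    (((tendsto_l2norm h2).add_const _).add (tendsto_l2norm h2'))
    (fun n => by
      rw [l2norm_sub_comm (ψ n) f]
      exact l2norm_sub_le (mφ n) hf (mψ n))
    (fun n => by
      have : gradient (fun x => φ n x - ψ n x) = fun x => gradient (φ n) x - gradient (ψ n) x :=
        funext fun x => gradient_sub (hφ1 n) (hψ1 n) x
      rw [this, l2norm_sub_comm (gradient (ψ n)) G']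
      exact (l2norm_sub_le (mgφ n) hG' (mgψ n)).trans
        (add_le_add_left (l2norm_sub_le (mgφ n) hG hG') _))
  have hzero : l2norm (facetMeasure (oppositeFacet K v)) (fun x => g x - g' x) = 0 := by
    refine le_antisymm ?_ (l2norm_nonneg _ _)
    have hlim := ((tendsto_l2norm h3).add key).add (tendsto_l2norm h3')
    simp only [add_zero] at hlim
    refine ge_of_tendsto' hlim fun n => ?_
    have nφ := hK.memLp_facetMeasure hd hv (hφ1 n).continuous
    have nψ := hK.memLp_facetMeasure hd hv (hψ1 n).continuous
    refine (l2norm_sub_le hg nψ hg').trans (add_le_add_left ?_ _)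
    refine (l2norm_sub_le hg nφ nψ).trans (add_le_add_left ?_ _)
    rw [l2norm_sub_comm]
  rw [l2norm, ENNReal.toReal_eq_zero_iff] at hzero
  have h0 : eLpNorm (g - g') 2 (facetMeasure (oppositeFacet K v)) = 0 :=
    hzero.resolve_right (hg.sub hg').2.ne
  rw [eLpNorm_eq_zero_iff (hg.sub hg').1 two_ne_zero] at h0
  filter_upwards [h0] with x hx
  exact sub_eq_zero.1 hx

lemma IsFacetTrace.sub_contDiff {d : ℕ} {K : Finset (Space d)} (hK : IsSimplex K)
    (hd : 1 ≤ d) {v : Space d} (hv : v ∈ K) {f g q : Space d → ℝ}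
    (h : IsFacetTrace K (oppositeFacet K v) f g) (hq : ContDiff ℝ ∞ q) :
    IsFacetTrace K (oppositeFacet K v) (fun x => f x - q x) (fun x => g x - q x) := by
  obtain ⟨hg, φ, G, hφ, hG, h1, h2, h3⟩ := h
  have hq1 : ContDiff ℝ 1 q := hq.of_le (by exact_mod_cast le_top)
  refine ⟨hg.sub (hK.memLp_facetMeasure hd hv hq.continuous), fun n x => φ n x - q x,
    fun x => G x - gradient q x, fun n => (hφ n).sub hq,
    hG.sub (memLp_cellMeasure K (continuous_gradient hq1)), ?_, ?_, ?_⟩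
  · simpa using h1
  · have : ∀ n x, gradient (fun x => φ n x - q x) x - (G x - gradient q x)
        = gradient (φ n) x - G x := by
      intro n x
      rw [gradient_sub ((hφ n).of_le (by exact_mod_cast le_top)) hq1]
      abel
    simpa [this] using h2
  · simpa using h3

/-- A function of `H¹₀(Ω)` has a trace on each facet of the mesh, common to the elements that
share the facet. -/
lemma exists_isFacetTrace {d : ℕ} (hd : 1 ≤ d) {T : Mesh d} {Ω : Set (Space d)}
    (hΩ : ∀ K ∈ T.cells, interior (hull K) ⊆ Ω) {u : Space d → ℝ} {G : Space d → Space d}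
    (hu : IsH10 Ω u G) {K₀ : Finset (Space d)} (hK₀ : K₀ ∈ T.cells) {v : Space d} (hv : v ∈ K₀) :
    ∃ g, ∀ K ∈ T.cells, oppositeFacet K₀ v ∈ cellFacets K →
      IsFacetTrace K (oppositeFacet K₀ v) u g := by
  obtain ⟨hmu, hmG, φ, hφ, h1, h2⟩ := hu
  have hφ1 : ∀ n, ContDiff ℝ 1 (φ n) := fun n => (hφ n).1.of_le (by exact_mod_cast le_top)
  have hS := T.isSimplex hK₀
  have nφ := fun n => hS.memLp_facetMeasure hd hv (hφ1 n).continuous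
  have hlim : ∀ K ∈ T.cells,
      Tendsto (fun n => eLpNorm (fun x => φ n x - u x) 2 (cellMeasure K)) atTop (𝓝 0) ∧
      Tendsto (fun n => eLpNorm (fun x => gradient (φ n) x - G x) 2 (cellMeasure K))
        atTop (𝓝 0) := fun K hK =>
    ⟨tendsto_of_tendsto_of_tendsto_of_le_of_le tendsto_const_nhds h1 (fun _ => zero_le)
      fun n => eLpNorm_mono_measure _ (cellMeasure_le (hΩ K hK)),
     tendsto_of_tendsto_of_tendsto_of_le_of_le tendsto_const_nhds h2 (fun _ => zero_le)
      fun n => eLpNorm_mono_measure _ (cellMeasure_le (hΩ K hK))⟩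
  have hmu₀ := hmu.mono_measure (cellMeasure_le (hΩ K₀ hK₀))
  have hmG₀ := hmG.mono_measure (cellMeasure_le (hΩ K₀ hK₀))
  have l1 := tendsto_l2norm (hlim K₀ hK₀).1
  have l2 := tendsto_l2norm (hlim K₀ hK₀).2
  have hfst : Tendsto (Prod.fst : ℕ × ℕ → ℕ) atTop atTop := by
    rw [← prod_atTop_atTop_eq]; exact tendsto_fst
  have hsnd : Tendsto (Prod.snd : ℕ × ℕ → ℕ) atTop atTop := by
    rw [← prod_atTop_atTop_eq]; exact tendsto_snd
  have key := hS.tendsto_l2norm_facet hd hv (l := (atTop : Filter (ℕ × ℕ)))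
    (φ := fun p x => φ p.1 x - φ p.2 x)
    (a := fun p => l2norm (cellMeasure K₀) (fun x => φ p.1 x - u x) +
      l2norm (cellMeasure K₀) (fun x => φ p.2 x - u x))
    (b := fun p => l2norm (cellMeasure K₀) (fun x => gradient (φ p.1) x - G x) +
      l2norm (cellMeasure K₀) (fun x => gradient (φ p.2) x - G x)) (B := 0 + 0)
    (fun p => (hφ1 p.1).sub (hφ1 p.2))
    (by simpa using (l1.comp hfst).add (l1.comp hsnd))
    ((l2.comp hfst).add (l2.comp hsnd))
    (fun p => by
      rw [l2norm_sub_comm (φ p.2) u]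
      exact l2norm_sub_le (memLp_cellMeasure _ (hφ1 _).continuous) hmu₀
        (memLp_cellMeasure _ (hφ1 _).continuous))
    (fun p => by
      have : gradient (fun x => φ p.1 x - φ p.2 x) =
          fun x => gradient (φ p.1) x - gradient (φ p.2) x :=
        funext fun x => gradient_sub (hφ1 _) (hφ1 _) x
      rw [this, l2norm_sub_comm (gradient (φ p.2)) G]
      exact l2norm_sub_le (memLp_cellMeasure _ (continuous_gradient (hφ1 _))) hmG₀
        (memLp_cellMeasure _ (continuous_gradient (hφ1 _))))
  have hcauchy : CauchySeq fun n => (nφ n).toLp (φ n) := by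
    rw [cauchySeq_iff_tendsto_dist_atTop_0]
    refine key.congr fun p => ?_
    rw [dist_eq_norm, ← MemLp.toLp_sub, Lp.norm_toLp]
    rfl
  obtain ⟨g, hg⟩ := cauchySeq_tendsto_of_complete hcauchy
  refine ⟨g, fun K hK hF => ⟨Lp.memLp g, φ, G, fun n => (hφ n).1,
    hmG.mono_measure (cellMeasure_le (hΩ K hK)), (hlim K hK).1, (hlim K hK).2, ?_⟩⟩
  rw [Lp.tendsto_Lp_iff_tendsto_eLpNorm'] at hg
  refine hg.congr fun n => eLpNorm_congr_ae ?_
  filter_upwards [(nφ n).coeFn_toLp] with x hx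
  simp [hx]

/-- On a facet of an element, the trace of `u - p` taken from the element is the skeleton trace of
`u` minus `p`. Both traces are arbitrarily chosen representatives, so this holds
almost everywhere. -/
lemma facetTrace_sub_skeletonTrace {d : ℕ} (hd : 1 ≤ d) {T : Mesh d} {Ω : Set (Space d)}
    (hΩ : ∀ K ∈ T.cells, interior (hull K) ⊆ Ω) {u : Space d → ℝ} {G : Space d → Space d}
    (hu : IsH10 Ω u G) {K : Finset (Space d)} (hK : K ∈ T.cells) {v : Space d} (hv : v ∈ K)
    {p : Space d → ℝ} (hp : ContDiff ℝ ∞ p) :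
    ∀ᵐ x ∂(facetMeasure (oppositeFacet K v)),
      facetTrace K (oppositeFacet K v) (fun x => u x - p x) x =
        skeletonTrace T u (oppositeFacet K v) x - p x := by
  have hS := T.isSimplex hK
  have h1 : ∀ K' ∈ T.cells, oppositeFacet K v ∈ cellFacets K' →
      IsFacetTrace K' (oppositeFacet K v) u (skeletonTrace T u (oppositeFacet K v)) :=
    Classical.epsilon_spec (exists_isFacetTrace hd hΩ hu hK hv)
  have h2 := (h1 K hK (hS.mem_cellFacets_iff.2 ⟨v, hv, rfl⟩)).sub_contDiff hS hd hv hp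
  have h3 : IsFacetTrace K (oppositeFacet K v) (fun x => u x - p x)
      (facetTrace K (oppositeFacet K v) (fun x => u x - p x)) :=
    Classical.epsilon_spec ⟨_, h2⟩
  exact h3.ae_eq hS hd hv
    ((hu.1.mono_measure (cellMeasure_le (hΩ K hK))).sub (memLp_cellMeasure K hp.continuous)) h2

/-! ### Polynomials and norm equivalence -/

section Poly
variable {d : ℕ}

lemma polyVal_add (p q : MvPolynomial (Fin d) ℝ) (x : Space d) :
    polyVal (p + q) x = polyVal p x + polyVal q x := by simp [polyVal]

lemma polyVal_sub (p q : MvPolynomial (Fin d) ℝ) (x : Space d) :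
    polyVal (p - q) x = polyVal p x - polyVal q x := by simp [polyVal]

lemma polyVal_mul (p q : MvPolynomial (Fin d) ℝ) (x : Space d) :
    polyVal (p * q) x = polyVal p x * polyVal q x := by simp [polyVal]

lemma hasFDerivAt_polyVal (p : MvPolynomial (Fin d) ℝ) (x : Space d) :
    HasFDerivAt (polyVal p)
      (∑ i, polyVal (MvPolynomial.pderiv i p) x • EuclideanSpace.proj (𝕜 := ℝ) i) x := by
  induction p using MvPolynomial.induction_on with
  | C a =>
    have h : polyVal (MvPolynomial.C a : MvPolynomial (Fin d) ℝ) = fun _ => a := by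
      ext; simp [polyVal]
    rw [h]
    simpa [polyVal] using hasFDerivAt_const (𝕜 := ℝ) a x
  | add p q hp hq =>
    have := hp.add hq
    simp only [map_add, polyVal_add, add_smul, Finset.sum_add_distrib]
    exact this.congr_of_eventuallyEq (Eventually.of_forall fun y => polyVal_add p q y)
  | mul_X p j hp =>
    have hX : HasFDerivAt (fun y : Space d => y j) (EuclideanSpace.proj (𝕜 := ℝ) j) x :=
      (EuclideanSpace.proj (𝕜 := ℝ) j).hasFDerivAt
    have h := hp.mul hX
    have hval : ∀ y : Space d, polyVal (p * MvPolynomial.X j) y = polyVal p y * y j := by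
      intro y; simp [polyVal]
    refine (h.congr_of_eventuallyEq (Eventually.of_forall hval)).congr_fderiv ?_
    ext y
    simp [polyVal, MvPolynomial.pderiv_X, Pi.single_apply, add_mul,
      Finset.sum_add_distrib, Finset.mul_sum, apply_ite]
    simp [mul_comm, mul_left_comm]

lemma contDiff_polyVal (p : MvPolynomial (Fin d) ℝ) {n : ℕ∞ω} : ContDiff ℝ n (polyVal p) := by
  induction p using MvPolynomial.induction_on with
  | C a =>
    have : polyVal (MvPolynomial.C a : MvPolynomial (Fin d) ℝ) = fun _ => a := by
      ext; simp [polyVal]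
    rw [this]; exact contDiff_const
  | add p q hp hq =>
    rw [show polyVal (p + q) = fun x => polyVal p x + polyVal q x from funext (polyVal_add p q)]
    exact hp.add hq
  | mul_X p j hp =>
    rw [show polyVal (p * MvPolynomial.X j) = fun x : Space d => polyVal p x * x j from
      funext fun x => by simp [polyVal]]
    exact hp.mul (EuclideanSpace.proj (𝕜 := ℝ) j).contDiff

@[fun_prop]
lemma continuous_polyVal (p : MvPolynomial (Fin d) ℝ) : Continuous (polyVal p) :=
  (contDiff_polyVal p (n := 1)).continuous

@[fun_prop]
lemma continuous_polyVec (p : Fin d → MvPolynomial (Fin d) ℝ) : Continuous (polyVec p) := by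
  unfold polyVec
  exact (PiLp.continuous_toLp 2 _).comp (continuous_pi fun i => continuous_polyVal (p i))

@[fun_prop]
lemma continuous_polyDiv (p : Fin d → MvPolynomial (Fin d) ℝ) : Continuous (polyDiv p) := by
  unfold polyDiv
  fun_prop

lemma fderiv_polyVal_single (p : MvPolynomial (Fin d) ℝ) (x : Space d) (i : Fin d) :
    fderiv ℝ (polyVal p) x (EuclideanSpace.single i 1) =
      polyVal (MvPolynomial.pderiv i p) x := by
  rw [(hasFDerivAt_polyVal p x).fderiv]
  simp

lemma totalDegree_bind₁_le {p : MvPolynomial (Fin d) ℝ}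
    {ℓ : Fin d → MvPolynomial (Fin d) ℝ} (hℓ : ∀ i, (ℓ i).totalDegree ≤ 1) :
    (MvPolynomial.bind₁ ℓ p).totalDegree ≤ p.totalDegree := by
  conv_lhs => rw [p.as_sum, map_sum]
  refine (MvPolynomial.totalDegree_finsetSum _ _).trans (Finset.sup_le fun m hm => ?_)
  rw [MvPolynomial.bind₁_monomial]
  refine (MvPolynomial.totalDegree_mul _ _).trans ?_
  rw [MvPolynomial.totalDegree_C, zero_add]
  refine (MvPolynomial.totalDegree_finsetProd _ _).trans ?_
  refine le_trans (Finset.sum_le_sum fun i _ => (MvPolynomial.totalDegree_pow _ _).trans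
    (Nat.mul_le_mul_left _ (hℓ i))) ?_
  simp only [mul_one]
  exact MvPolynomial.le_totalDegree hm

/-- Polynomials of degree at most `k` are stable under substitution of functions which are
polynomials of degree at most one in each coordinate. -/
lemma exists_polyVal_comp {k : ℕ} {p : MvPolynomial (Fin d) ℝ} (hp : p.totalDegree ≤ k)
    {A : Space d → Space d}
    (hA : ∀ i, ∃ ℓ : MvPolynomial (Fin d) ℝ, ℓ.totalDegree ≤ 1 ∧ ∀ x, polyVal ℓ x = A x i) :
    ∃ q : MvPolynomial (Fin d) ℝ, q.totalDegree ≤ k ∧ ∀ x, polyVal q x = polyVal p (A x) := by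
  choose ℓ hℓ hA using hA
  refine ⟨MvPolynomial.bind₁ ℓ p, (totalDegree_bind₁_le hℓ).trans hp, fun x => ?_⟩
  rw [polyVal, polyVal]
  have h := MvPolynomial.eval₂Hom_bind₁ (RingHom.id ℝ) (fun i => x i) ℓ p
  change MvPolynomial.eval₂Hom (RingHom.id ℝ) (fun i => x i) _ = _
  rw [h]
  have h2 : (fun i => MvPolynomial.eval₂Hom (RingHom.id ℝ) (fun i => x i) (ℓ i)) =
      fun i => A x i := funext fun i => hA i x
  rw [h2]
  rfl

lemma totalDegree_add_le_of_le {k : ℕ} {p q : MvPolynomial (Fin d) ℝ} (hp : p.totalDegree ≤ k)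
    (hq : q.totalDegree ≤ k) : (p + q).totalDegree ≤ k :=
  (MvPolynomial.totalDegree_add p q).trans (max_le hp hq)

lemma totalDegree_C_mul_le {k : ℕ} (a : ℝ) {p : MvPolynomial (Fin d) ℝ} (hp : p.totalDegree ≤ k) :
    (MvPolynomial.C a * p).totalDegree ≤ k := by
  refine (MvPolynomial.totalDegree_mul _ _).trans ?_
  rw [MvPolynomial.totalDegree_C, zero_add]
  exact hp

lemma exists_polyVal_affineMap (f : Space d →ᵃ[ℝ] ℝ) :
    ∃ ℓ : MvPolynomial (Fin d) ℝ, ℓ.totalDegree ≤ 1 ∧ ∀ x, polyVal ℓ x = f x := by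
  refine ⟨MvPolynomial.C (f 0) +
    ∑ i, MvPolynomial.C (f.linear (EuclideanSpace.single i 1)) * MvPolynomial.X i,
    totalDegree_add_le_of_le (by simp) ?_, fun x => ?_⟩
  · exact (MvPolynomial.totalDegree_finsetSum _ _).trans (Finset.sup_le fun i _ =>
      totalDegree_C_mul_le _ (MvPolynomial.totalDegree_X i).le)
  · have h1 : f x = f.linear x + f 0 := by
      have := f.map_vadd 0 x
      simpa using this
    have h2 := inner_eq_sum_single f.linear.toContinuousLinearMap x
    rw [LinearMap.coe_toContinuousLinearMap'] at h2
    rw [h1, ← h2, add_comm]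
    simp [polyVal]

lemma polyVal_eq_zero_of_eqOn_ball {p : MvPolynomial (Fin d) ℝ} {r : ℝ} (hr : 0 < r)
    (h : ∀ x ∈ Metric.ball (0 : Space d) r, polyVal p x = 0) : p = 0 := by
  have hcont : Continuous fun y : Fin d → ℝ => (WithLp.toLp 2 y : Space d) :=
    PiLp.continuous_toLp 2 _
  have hopen : IsOpen ((fun y : Fin d → ℝ => (WithLp.toLp 2 y : Space d)) ⁻¹' Metric.ball 0 r) :=
    Metric.isOpen_ball.preimage hcont
  obtain ⟨ε, hε, hsub⟩ := Metric.isOpen_iff.1 hopen 0 (by simpa using hr)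
  refine MvPolynomial.funext_set (fun _ => Set.Ioo (-ε) ε) (fun _ => Set.Ioo_infinite (by linarith))
    fun y hy => ?_
  have hy' : y ∈ Metric.ball (0 : Fin d → ℝ) ε := by
    rw [Metric.mem_ball, dist_pi_lt_iff hε]
    intro i
    have := hy i trivial
    rw [Real.dist_eq, Pi.zero_apply, sub_zero, abs_lt]
    exact this
  have := h _ (hsub hy')
  simpa [polyVal] using this

end Poly

lemma exists_bilinForm_le_norm {V : Type*} [NormedAddCommGroup V] [InnerProductSpace ℝ V]
    [FiniteDimensional ℝ V] (B : V →ₗ[ℝ] V →ₗ[ℝ] ℝ) :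
    ∃ C : ℝ, 0 ≤ C ∧ ∀ v, B v v ≤ C * (‖v‖ * ‖v‖) := by
  let Bc : V →L[ℝ] V →L[ℝ] ℝ := LinearMap.toContinuousLinearMap
    ((LinearMap.toContinuousLinearMap (𝕜 := ℝ) (E := V) (F' := ℝ)).toLinearMap ∘ₗ B)
  refine ⟨‖Bc‖, Bc.opNorm_nonneg, fun v => ?_⟩
  rw [← mul_assoc]
  exact (le_abs_self _).trans (Bc.le_opNorm₂ v v)

/-- On a finite-dimensional space every quadratic form is bounded by a multiple of a given positive
definite one. -/
lemma exists_bilinForm_le {V : Type*} [AddCommGroup V] [Module ℝ V] [FiniteDimensional ℝ V]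
    (B B' : V →ₗ[ℝ] V →ₗ[ℝ] ℝ) (hsymm : ∀ v w, B v w = B w v) (hpos : ∀ v, 0 ≤ B v v)
    (hdef : ∀ v, B v v = 0 → v = 0) : ∃ C : ℝ, 0 ≤ C ∧ ∀ v, B' v v ≤ C * B v v := by
  let core : InnerProductSpace.Core ℝ V :=
    { inner := fun v w => B v w
      conj_inner_symm := fun v w => by simp [hsymm v w]
      re_inner_nonneg := fun v => by simpa using hpos v
      add_left := fun u v w => by simp
      smul_left := fun u v r => by simp
      definite := hdef }
  obtain ⟨C, hC, h⟩ := @exists_bilinForm_le_norm V core.toNormedAddCommGroup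
    (InnerProductSpace.ofCore core.toCore) _ B'
  refine ⟨C, hC, fun v => (h v).trans_eq ?_⟩
  congr 1
  exact (@real_inner_self_eq_norm_mul_norm V core.toNormedAddCommGroup.toSeminormedAddCommGroup
    (InnerProductSpace.ofCore core.toCore) v).symm

/-- The form `(v, w) ↦ ∫_S L(v) L(w)` for a linear map `L` into the continuous functions. -/
def integralForm {d : ℕ} {V : Type*} [AddCommGroup V] [Module ℝ V] {S : Set (Space d)}
    (hS : IsCompact S) (L : V →ₗ[ℝ] Space d → ℝ) (hL : ∀ v, Continuous (L v)) :
    V →ₗ[ℝ] V →ₗ[ℝ] ℝ :=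
  have hint : ∀ v w, IntegrableOn (fun x => L v x * L w x) S volume := fun v w =>
    ((hL v).mul (hL w)).continuousOn.integrableOn_compact hS
  LinearMap.mk₂ ℝ (fun v w => ∫ x in S, L v x * L w x)
    (fun v v' w => by simp [add_mul, integral_add (hint v w) (hint v' w)])
    (fun c v w => by simp [mul_assoc, integral_const_mul])
    (fun v w w' => by simp [mul_add, integral_add (hint v w) (hint v w')])
    (fun c v w => by simp [mul_left_comm, integral_const_mul])

lemma exists_setIntegral_sq_le {d : ℕ} {V : Type*} [AddCommGroup V] [Module ℝ V]
    [FiniteDimensional ℝ V] {S S' : Set (Space d)} (hS : IsCompact S) (hS' : IsCompact S')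
    (L L' : V →ₗ[ℝ] Space d → ℝ) (hL : ∀ v, Continuous (L v)) (hL' : ∀ v, Continuous (L' v))
    (hdef : ∀ v, ∫ x in S, L v x ^ 2 = 0 → v = 0) :
    ∃ C : ℝ, 0 ≤ C ∧ ∀ v, ∫ x in S', L' v x ^ 2 ≤ C * ∫ x in S, L v x ^ 2 := by
  have h1 : ∀ v, integralForm hS L hL v v = ∫ x in S, L v x ^ 2 := fun v => by
    simp [integralForm, sq]
  have h2 : ∀ v, integralForm hS' L' hL' v v = ∫ x in S', L' v x ^ 2 := fun v => by
    simp [integralForm, sq]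
  obtain ⟨C, hC, h⟩ := exists_bilinForm_le (integralForm hS L hL) (integralForm hS' L' hL')
    (fun v w => by simp [integralForm, mul_comm])
    (fun v => by rw [h1]; exact integral_nonneg fun x => sq_nonneg _)
    (fun v hv => hdef v (by rwa [h1] at hv))
  exact ⟨C, hC, fun v => by rw [← h1, ← h2]; exact h v⟩

/-! ### Inverse estimates by scaling -/

/-- A fixed smooth cut-off function, supported in the ball of radius `1/2` and equal to one on the
ball of radius `1/4`. -/
def unitBump (d : ℕ) : ContDiffBump (0 : Space d) := ⟨1 / 4, 1 / 2, by norm_num, by norm_num⟩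

lemma contDiff_unitBump (d : ℕ) {n : ℕ∞} : ContDiff ℝ n (unitBump d) := (unitBump d).contDiff

lemma norm_gradient_sq {d : ℕ} (φ : Space d → ℝ) (x : Space d) :
    ‖gradient φ x‖ ^ 2 = ∑ i, fderiv ℝ φ x (EuclideanSpace.single i 1) ^ 2 := by
  rw [EuclideanSpace.norm_sq_eq]
  refine Finset.sum_congr rfl fun i _ => ?_
  rw [← inner_gradient, EuclideanSpace.inner_single_right]
  simp

/-- Norm equivalence on the polynomials of degree at most `k`, on a ball of fixed size: the `L²`
norms over a large ball of a polynomial, and of the gradient of its product with the cut-off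
function, are controlled by the `L²` norm over a small ball. -/
lemma exists_unit_inverse_estimate (d k : ℕ) (M : ℝ) :
    ∃ C : ℝ, 0 ≤ C ∧ ∀ p : MvPolynomial (Fin d) ℝ, p.totalDegree ≤ k →
      ∫ x in Metric.closedBall (0 : Space d) M, polyVal p x ^ 2 ≤
        C * ∫ x in Metric.closedBall (0 : Space d) (1 / 4), polyVal p x ^ 2 ∧
      ∫ x in Metric.closedBall (0 : Space d) M,
          ‖gradient (fun y => unitBump d y * polyVal p y) x‖ ^ 2 ≤
        C * ∫ x in Metric.closedBall (0 : Space d) (1 / 4), polyVal p x ^ 2 := by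
  set V := MvPolynomial.restrictTotalDegree (Fin d) ℝ k
  have hcd : ∀ p : MvPolynomial (Fin d) ℝ, ContDiff ℝ 1 fun y => unitBump d y * polyVal p y :=
    fun p => (contDiff_unitBump d (n := 1)).mul (contDiff_polyVal p)
  let L : V →ₗ[ℝ] Space d → ℝ :=
    { toFun := fun p => polyVal p.1
      map_add' := fun p q => funext fun x => polyVal_add p.1 q.1 x
      map_smul' := fun c p => funext fun x => by simp [polyVal] }
  let L' : Fin d → V →ₗ[ℝ] Space d → ℝ := fun i =>
    { toFun := fun p x => fderiv ℝ (fun y => unitBump d y * polyVal p.1 y) x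
        (EuclideanSpace.single i 1)
      map_add' := fun p q => funext fun x => by
        have h : (fun y => unitBump d y * polyVal (p + q : V).1 y) =
            (fun y => unitBump d y * polyVal p.1 y) + fun y => unitBump d y * polyVal q.1 y := by
          ext y; simp [polyVal_add, mul_add]
        rw [h, fderiv_add ((hcd _).differentiable one_ne_zero x)
          ((hcd _).differentiable one_ne_zero x)]
        rfl
      map_smul' := fun c p => funext fun x => by
        have h : (fun y => unitBump d y * polyVal (c • p : V).1 y) =
            c • fun y => unitBump d y * polyVal p.1 y := by
          ext y; simp [polyVal, mul_left_comm]
        rw [h, fderiv_const_smul ((hcd _).differentiable one_ne_zero x)]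
        rfl }
  have hL : ∀ p, Continuous (L p) := fun p => continuous_polyVal p.1
  have hL' : ∀ i p, Continuous (L' i p) := fun i p =>
    ((hcd p.1).continuous_fderiv one_ne_zero).clm_apply continuous_const
  have hS := isCompact_closedBall (0 : Space d) (1 / 4)
  have hS' := isCompact_closedBall (0 : Space d) M
  have hdef : ∀ p, ∫ x in Metric.closedBall (0 : Space d) (1 / 4), L p x ^ 2 = 0 → p = 0 := by
    intro p hp
    have hint : IntegrableOn (fun x => L p x ^ 2)
        (Metric.closedBall (0 : Space d) (1 / 4)) volume :=
      ((hL p).pow 2).continuousOn.integrableOn_compact hS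
    rw [setIntegral_eq_zero_iff_of_nonneg_ae (Eventually.of_forall fun x => sq_nonneg _) hint] at hp
    have hp' := ae_restrict_of_ae_restrict_of_subset Metric.ball_subset_closedBall hp
    have h0 := Measure.eqOn_open_of_ae_eq hp' Metric.isOpen_ball ((hL p).pow 2).continuousOn
      continuousOn_const
    exact Subtype.ext (polyVal_eq_zero_of_eqOn_ball (by norm_num : (0 : ℝ) < 1 / 4)
      fun x hx => by simpa [L] using h0 hx)
  obtain ⟨C₀, hC₀, h₀⟩ := exists_setIntegral_sq_le hS hS' L L hL hL hdef
  choose C hC h using fun i => exists_setIntegral_sq_le hS hS' L (L' i) hL (hL' i) hdef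
  refine ⟨C₀ + ∑ i, C i, add_nonneg hC₀ (Finset.sum_nonneg fun i _ => hC i), fun p hp => ?_⟩
  have hI : 0 ≤ ∫ x in Metric.closedBall (0 : Space d) (1 / 4), polyVal p x ^ 2 :=
    integral_nonneg fun x => sq_nonneg _
  have hs : 0 ≤ ∑ i, C i := Finset.sum_nonneg fun i _ => hC i
  have hpV : p ∈ V := (MvPolynomial.mem_restrictTotalDegree _ _ _).2 hp
  constructor
  · refine (h₀ ⟨p, hpV⟩).trans ?_
    exact mul_le_mul_of_nonneg_right (by linarith) hI
  · simp_rw [norm_gradient_sq]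
    have hi : ∀ i ∈ Finset.univ, IntegrableOn (fun x => fderiv ℝ
        (fun y => unitBump d y * polyVal p y) x (EuclideanSpace.single i 1) ^ 2)
        (Metric.closedBall (0 : Space d) M) volume := fun i _ =>
      ((hL' i ⟨p, hpV⟩).pow 2).continuousOn.integrableOn_compact hS'
    rw [integral_finsetSum _ hi]
    refine (Finset.sum_le_sum fun i _ => h i ⟨p, hpV⟩).trans ?_
    rw [← Finset.sum_mul]
    exact mul_le_mul_of_nonneg_right (by linarith) hI

lemma setIntegral_closedBall_scale {d : ℕ} (z : Space d) {ρ : ℝ} (hρ : 0 < ρ) (R : ℝ)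
    (g : Space d → ℝ) :
    ∫ x in Metric.closedBall z (ρ * R), g x =
      ρ ^ d * ∫ y in Metric.closedBall (0 : Space d) R, g (z + ρ • y) := by
  rw [← integral_indicator Metric.isClosed_closedBall.measurableSet,
    ← integral_indicator Metric.isClosed_closedBall.measurableSet]
  set F := (Metric.closedBall z (ρ * R)).indicator g with hF
  have h1 : ∀ y, (Metric.closedBall (0 : Space d) R).indicator (fun y => g (z + ρ • y)) y
      = F (z + ρ • y) := by
    intro y
    have hiff : y ∈ Metric.closedBall (0 : Space d) R ↔
        z + ρ • y ∈ Metric.closedBall z (ρ * R) := by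
      rw [Metric.mem_closedBall, Metric.mem_closedBall, dist_zero_right, dist_self_add_left,
        norm_smul, Real.norm_of_nonneg hρ.le, mul_le_mul_iff_right₀ hρ]
    by_cases hy : y ∈ Metric.closedBall (0 : Space d) R
    · rw [Set.indicator_of_mem hy, hF, Set.indicator_of_mem (hiff.1 hy)]
    · rw [Set.indicator_of_notMem hy, hF, Set.indicator_of_notMem fun h => hy (hiff.2 h)]
  simp_rw [h1]
  rw [Measure.integral_comp_smul volume (fun y => F (z + y)) ρ, integral_add_left_eq_self,
    finrank_euclideanSpace_fin, abs_of_pos (by positivity), smul_eq_mul, ← mul_assoc,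
    mul_inv_cancel₀ (by positivity), one_mul]

/-- Multiplication by a scaled cut-off function: for a polynomial `p` on a shape-regular element
there is a smooth function `φ`, compactly supported in its interior, which captures the `L²` norm
of `p` and obeys an inverse estimate. -/
lemma exists_bubble (d k : ℕ) (κ : ℝ) :
    ∃ C : ℝ, 0 ≤ C ∧ ∀ (K : Finset (Space d)) (z : Space d) (ρ : ℝ), 0 < ρ →
      Metric.closedBall z ρ ⊆ hull K → meshSize K ≤ κ * (2 * ρ) →
      ∀ p : MvPolynomial (Fin d) ℝ, p.totalDegree ≤ k →
      ∃ φ : Space d → ℝ, ContDiff ℝ ∞ φ ∧ HasCompactSupport φ ∧ tsupport φ ⊆ interior (hull K) ∧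
        l2norm (cellMeasure K) φ ≤ l2norm (cellMeasure K) (polyVal p) ∧
        l2norm (cellMeasure K) (polyVal p) ^ 2 ≤ C * ∫ x, polyVal p x * φ x ∂(cellMeasure K) ∧
        meshSize K * l2norm (cellMeasure K) (gradient φ) ≤
          C * l2norm (cellMeasure K) (polyVal p) := by
  obtain ⟨C, hC, hest⟩ := exists_unit_inverse_estimate d k (2 * κ)
  refine ⟨C + 2 * |κ| * √C, by positivity, fun K z ρ hρ hball hκ p hp => ?_⟩
  obtain ⟨P, hP, hPp⟩ := exists_polyVal_comp hp (A := fun y => z + ρ • y) fun i =>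
    ⟨MvPolynomial.C (z i) + MvPolynomial.C ρ * MvPolynomial.X i,
      totalDegree_add_le_of_le (by simp)
        (totalDegree_C_mul_le _ (MvPolynomial.totalDegree_X i).le), fun x => by simp [polyVal]⟩
  obtain ⟨hest1, hest2⟩ := hest P hP
  set η := unitBump d
  set s : Space d → Space d := fun x => ρ⁻¹ • (x - z) with hs
  have hsc : ∀ n : ℕ∞ω, ContDiff ℝ n s := fun n => by
    rw [hs]; fun_prop
  have hsz : ∀ y, s (z + ρ • y) = y := fun y => by
    rw [hs]; simp [smul_smul, inv_mul_cancel₀ hρ.ne']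
  set φ : Space d → ℝ := fun x => η (s x) * polyVal p x with hφ
  have hφc : ContDiff ℝ ∞ φ := ((contDiff_unitBump d).comp (hsc _)).mul (contDiff_polyVal p)
  have hφ1 : ContDiff ℝ 1 φ := hφc.of_le (by exact_mod_cast le_top)
  have hball0 : Metric.closedBall z (ρ * (1 / 4)) ⊆ hull K :=
    (Metric.closedBall_subset_closedBall (by linarith)).trans hball
  have hbig : hull K ⊆ Metric.closedBall z (ρ * (2 * κ)) := by
    intro x hx
    rw [Metric.mem_closedBall]
    refine (Metric.dist_le_diam_of_mem (isCompact_hull K).isBounded hx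
      (hball (Metric.mem_closedBall_self hρ.le))).trans (hκ.trans_eq ?_)
    ring
  have hsupp : tsupport φ ⊆ Metric.closedBall z (ρ * (1 / 2)) := by
    refine closure_minimal (fun x hx => ?_) Metric.isClosed_closedBall
    have h1 : s x ∈ Function.support η := fun h => hx (by rw [hφ]; simp [h])
    rw [η.support_eq, mem_ball_zero_iff, hs, norm_smul, norm_inv, Real.norm_of_nonneg hρ.le,
      ← dist_eq_norm, inv_mul_lt_iff₀ hρ] at h1
    exact h1.le
  have hmp := memLp_cellMeasure K (continuous_polyVal p)
  have hmφ := memLp_cellMeasure K hφc.continuous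
  have hmg := memLp_cellMeasure K (continuous_gradient hφ1)
  have hA := l2norm_nonneg (cellMeasure K) (polyVal p)
  have hpc := continuous_polyVal p
  have hI : ∀ {S : Set (Space d)} {g : Space d → ℝ}, IsCompact S → Continuous g →
      IntegrableOn g S volume := fun hS hg => hg.continuousOn.integrableOn_compact hS
  -- The small ball on which the cut-off function is one.
  have hsmall : ∫ x in Metric.closedBall z (ρ * (1 / 4)), polyVal p x ^ 2 ≤
      ∫ x, polyVal p x * φ x ∂(cellMeasure K) := by
    have h1 : ∫ x in Metric.closedBall z (ρ * (1 / 4)), polyVal p x ^ 2 =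
        ∫ x in Metric.closedBall z (ρ * (1 / 4)), polyVal p x * φ x := by
      refine setIntegral_congr_fun Metric.isClosed_closedBall.measurableSet fun x hx => ?_
      have : s x ∈ Metric.closedBall 0 η.rIn := by
        rw [mem_closedBall_zero_iff, hs, norm_smul, norm_inv, Real.norm_of_nonneg hρ.le,
          ← dist_eq_norm, inv_mul_le_iff₀ hρ]
        exact hx
      simp only [hφ, η.one_of_mem_closedBall this]
      ring
    rw [h1]
    refine setIntegral_mono_set (hI (isCompact_hull K) (hpc.mul hφc.continuous))
      (Eventually.of_forall fun x => ?_) hball0.eventuallyLE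
    have : polyVal p x * φ x = η (s x) * polyVal p x ^ 2 := by simp only [hφ]; ring
    refine le_of_le_of_eq ?_ this.symm
    exact mul_nonneg η.nonneg (sq_nonneg _)
  have hsmall' : ∫ x in Metric.closedBall z (ρ * (1 / 4)), polyVal p x ^ 2 ≤
      l2norm (cellMeasure K) (polyVal p) ^ 2 := by
    rw [l2norm_sq_real hmp]
    exact setIntegral_mono_set (hI (isCompact_hull K) (hpc.pow 2))
      (Eventually.of_forall fun x => sq_nonneg _) hball0.eventuallyLE
  rw [setIntegral_closedBall_scale z hρ] at hsmall hsmall'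
  simp_rw [← hPp] at hsmall hsmall'
  have hρd : 0 < ρ ^ d := by positivity
  refine ⟨φ, hφc, ?_, ?_, ?_, ?_, ?_⟩
  · exact HasCompactSupport.of_support_subset_isCompact (isCompact_closedBall z (ρ * (1 / 2)))
      ((subset_tsupport φ).trans hsupp)
  · refine hsupp.trans ((Metric.closedBall_subset_ball (by linarith)).trans
      (interior_maximal (Metric.ball_subset_closedBall.trans hball) Metric.isOpen_ball))
  · refine (l2norm_le_mul hmp zero_le_one (Eventually.of_forall fun x => ?_)).trans_eq (one_mul _)
    rw [hφ, norm_mul, Real.norm_of_nonneg η.nonneg]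
    exact mul_le_mul_of_nonneg_right η.le_one (norm_nonneg _)
  · have h1 : l2norm (cellMeasure K) (polyVal p) ^ 2 ≤
        C * ∫ x, polyVal p x * φ x ∂(cellMeasure K) := by
      rw [l2norm_sq_real hmp]
      refine (setIntegral_mono_set (hI (isCompact_closedBall z (ρ * (2 * κ))) (hpc.pow 2))
        (Eventually.of_forall fun x => sq_nonneg _) hbig.eventuallyLE).trans ?_
      rw [setIntegral_closedBall_scale z hρ]
      simp only [Pi.pow_apply, ← hPp]
      refine (mul_le_mul_of_nonneg_left hest1 hρd.le).trans ?_
      rw [mul_left_comm]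
      exact mul_le_mul_of_nonneg_left hsmall hC
    have h2 : 0 ≤ ∫ x, polyVal p x * φ x ∂(cellMeasure K) :=
      le_trans (mul_nonneg hρd.le (integral_nonneg fun x => sq_nonneg _)) hsmall
    refine h1.trans (mul_le_mul_of_nonneg_right ?_ h2)
    linarith [show 0 ≤ 2 * |κ| * √C by positivity]
  · have hgrad : ∀ y, gradient φ (z + ρ • y) =
        ρ⁻¹ • gradient (fun y => η y * polyVal P y) y := by
      intro y
      have hψ : φ = (fun y => η y * polyVal P y) ∘ s := by
        ext x
        have : z + ρ • s x = x := by rw [hs]; simp [smul_smul, mul_inv_cancel₀ hρ.ne']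
        simp only [hφ, Function.comp, hPp, this]
      have hds : HasFDerivAt s (ρ⁻¹ • ContinuousLinearMap.id ℝ (Space d)) (z + ρ • y) :=
        ((hasFDerivAt_id _).sub_const z).const_smul ρ⁻¹
      have hdψ : DifferentiableAt ℝ (fun y => η y * polyVal P y) (s (z + ρ • y)) :=
        ((contDiff_unitBump d (n := 1)).mul (contDiff_polyVal P)).differentiable one_ne_zero _
      have h1 := (hdψ.hasFDerivAt.comp _ hds).fderiv
      refine ext_inner_right ℝ fun w => ?_
      rw [inner_gradient, real_inner_smul_left, inner_gradient, hψ, h1, hsz]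
      simp
    have h1 : l2norm (cellMeasure K) (gradient φ) ^ 2 ≤
        ρ⁻¹ ^ 2 * (C * l2norm (cellMeasure K) (polyVal p) ^ 2) := by
      rw [l2norm_sq hmg]
      simp_rw [real_inner_self_eq_norm_sq]
      refine (setIntegral_mono_set (hI (isCompact_closedBall z (ρ * (2 * κ)))
        ((continuous_gradient hφ1).norm.pow 2))
        (Eventually.of_forall fun x => sq_nonneg _) hbig.eventuallyLE).trans ?_
      rw [setIntegral_closedBall_scale z hρ]
      simp only [Pi.pow_apply, hgrad, norm_smul, mul_pow]
      rw [integral_const_mul, norm_inv, Real.norm_of_nonneg hρ.le, mul_left_comm]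
      refine mul_le_mul_of_nonneg_left ?_ (by positivity)
      refine (mul_le_mul_of_nonneg_left hest2 hρd.le).trans ?_
      rw [mul_left_comm]
      exact mul_le_mul_of_nonneg_left hsmall' hC
    have hB := l2norm_nonneg (cellMeasure K) (gradient φ)
    have h2 : ρ * l2norm (cellMeasure K) (gradient φ) ≤
        √C * l2norm (cellMeasure K) (polyVal p) := by
      refine abs_le_of_sq_le_sq' ?_ (by positivity) |>.2
      rw [mul_pow, mul_pow, Real.sq_sqrt hC]
      refine (mul_le_mul_of_nonneg_left h1 (sq_nonneg ρ)).trans_eq ?_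
      field_simp
    calc meshSize K * l2norm (cellMeasure K) (gradient φ)
        ≤ (|κ| * (2 * ρ)) * l2norm (cellMeasure K) (gradient φ) := by
          refine mul_le_mul_of_nonneg_right (hκ.trans ?_) hB
          exact mul_le_mul_of_nonneg_right (le_abs_self κ) (by positivity)
      _ = 2 * |κ| * (ρ * l2norm (cellMeasure K) (gradient φ)) := by ring
      _ ≤ 2 * |κ| * (√C * l2norm (cellMeasure K) (polyVal p)) := by gcongr
      _ ≤ _ := by nlinarith [mul_nonneg hC hA]

/-! ### The discrete equations on one element -/

section

variable {d : ℕ}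

lemma totalDegree_pderiv_le {k : ℕ} {p : MvPolynomial (Fin d) ℝ} (hp : p.totalDegree ≤ k)
    (i : Fin d) : (MvPolynomial.pderiv i p).totalDegree ≤ k := by
  rw [p.as_sum, map_sum]
  refine (MvPolynomial.totalDegree_finsetSum _ _).trans (Finset.sup_le fun m hm => ?_)
  rw [MvPolynomial.pderiv_monomial]
  refine (MvPolynomial.totalDegree_monomial_le _ _).trans (le_trans ?_
    ((MvPolynomial.le_totalDegree hm).trans hp))
  classical
  exact Finsupp.sum_le_sum_index tsub_le_self (fun _ _ => monotone_id) fun _ _ => rfl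

/-- The divergence of a polynomial field as a polynomial. -/
def divPoly (p : Fin d → MvPolynomial (Fin d) ℝ) : MvPolynomial (Fin d) ℝ :=
  ∑ i, MvPolynomial.pderiv i (p i)

lemma polyVal_divPoly (p : Fin d → MvPolynomial (Fin d) ℝ) (x : Space d) :
    polyVal (divPoly p) x = polyDiv p x := by
  simp [divPoly, polyDiv, polyVal]

lemma totalDegree_divPoly_le {k : ℕ} {p : Fin d → MvPolynomial (Fin d) ℝ}
    (hp : ∀ i, (p i).totalDegree ≤ k) : (divPoly p).totalDegree ≤ k :=
  (MvPolynomial.totalDegree_finsetSum _ _).trans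
    (Finset.sup_le fun i _ => totalDegree_pderiv_le (hp i) i)

lemma inner_polyVec (p : Fin d → MvPolynomial (Fin d) ℝ) (x y : Space d) :
    inner ℝ (polyVec p x) y = ∑ i, polyVal (p i) x * y i := by
  simp [polyVec, PiLp.inner_apply, mul_comm]

lemma IsSimplex.integral_polyDiv_mul {K : Finset (Space d)} (hK : IsSimplex K) (hd : 1 ≤ d)
    (p : Fin d → MvPolynomial (Fin d) ℝ) (v : MvPolynomial (Fin d) ℝ) :
    ∫ x, polyDiv p x * polyVal v x ∂(cellMeasure K) +
      ∫ x, inner ℝ (polyVec p x) (polyGrad v x) ∂(cellMeasure K) =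
    ∑ u ∈ K, ∫ x, inner ℝ (polyVec p x) (outwardNormal K (oppositeFacet K u)) * polyVal v x
      ∂(facetMeasure (oppositeFacet K u)) := by
  have h := hK.integral_div_eq_sum_facets hd (V := fun i => polyVal (p i * v))
    fun i => contDiff_polyVal _
  have h1 : ∀ x, ∑ i, fderiv ℝ (polyVal (p i * v)) x (EuclideanSpace.single i 1) =
      polyDiv p x * polyVal v x + inner ℝ (polyVec p x) (polyGrad v x) := by
    intro x
    rw [inner_polyVec, polyDiv, Finset.sum_mul, ← Finset.sum_add_distrib]
    refine Finset.sum_congr rfl fun i _ => ?_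
    rw [fderiv_polyVal_single, MvPolynomial.pderiv_mul, polyVal_add, polyVal_mul, polyVal_mul]
    simp [polyGrad, polyVec]
  have h2 : ∀ x n : Space d, inner ℝ (WithLp.toLp 2 fun i => polyVal (p i * v) x : Space d) n =
      inner ℝ (polyVec p x) n * polyVal v x := by
    intro x n
    rw [inner_polyVec, PiLp.inner_apply, Finset.sum_mul]
    refine Finset.sum_congr rfl fun i _ => ?_
    simp [polyVal_mul]
    ring
  simp_rw [h1, h2] at h
  rw [← h, integral_add]
  · exact integrable_cellMeasure (by fun_prop)
  · refine integrable_cellMeasure ?_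
    unfold polyGrad
    fun_prop

open Classical in
/-- The discrete triple whose only component is the polynomial `v` on the element `K`. -/
def localPotential (K : Finset (Space d)) (v : MvPolynomial (Fin d) ℝ) : DiscreteTriple d where
  flux _ _ := 0
  pot K' := if K' = K then v else 0
  hat _ := 0

/-- The HDG equations tested with a potential supported in one element, after integration by
parts: the jump on the stabilized facet is driven by the residual `f + div σ_h`. -/
lemma integral_jump_mul_eq (hd : 1 ≤ d) {T : Mesh d} {Ω : Set (Space d)} {k : ℕ}
    {aK : Finset (Space d) → ℝ} {Fstar : Finset (Space d) → Finset (Space d)} {f : Space d → ℝ}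
    {X : DiscreteTriple d}
    (hX : IsMixedHDGSolution T Ω k aK (singleFacetStabilization aK Fstar) f X)
    {K : Finset (Space d)} (hKT : K ∈ T.cells) (hf : MemLp f 2 (cellMeasure K))
    {w : Space d} (hw : w ∈ K) (hF : Fstar K = oppositeFacet K w)
    {v : MvPolynomial (Fin d) ℝ} (hv : v.totalDegree ≤ k) :
    aK K * ∫ x, polyVal (X.pot K - X.hat (Fstar K)) x * polyVal v x ∂(facetMeasure (Fstar K)) =
      ∫ x, (f x + polyDiv (X.flux K) x) * polyVal v x ∂(cellMeasure K) := by
  have hK := T.isSimplex hKT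
  have hmem : (localPotential K v).Mem T Ω k := by
    refine ⟨fun _ _ i => by simp [localPotential], fun K' _ => ?_, fun _ _ => by
      simp [localPotential], fun _ _ _ x _ => by simp [localPotential, polyVal]⟩
    simp only [localPotential]
    split_ifs
    · exact hv
    · simp
  have hz : ∀ x : Space d, polyVal (0 : MvPolynomial (Fin d) ℝ) x = 0 := fun x => by
    simp [polyVal]
  have hzv : ∀ x : Space d, polyVec (fun _ => (0 : MvPolynomial (Fin d) ℝ)) x = 0 := fun x => by
    ext i; simp [polyVec, hz]
  have hzd : ∀ x : Space d, polyDiv (fun _ => (0 : MvPolynomial (Fin d) ℝ)) x = 0 := fun x => by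
    simp [polyDiv, hz]
  have hzg : ∀ x : Space d, polyGrad (0 : MvPolynomial (Fin d) ℝ) x = 0 := fun x => by
    ext i; simp [polyGrad, polyVec, hz]
  have h := hX.2 _ hmem
  rw [bilinearForm, linearForm, Finset.sum_eq_single (s := T.cells) K,
    Finset.sum_eq_single (s := T.cells) K] at h
  rotate_left
  · intro K' _ hne
    simp [localPotential, hne, hz]
  · exact fun h => absurd hKT h
  · intro K' _ hne
    simp [localPotential, hne, hz, hzv, hzd, hzg]
  · exact fun h => absurd hKT h
  simp only [localPotential, if_true, hzv, hzd, hz, inner_zero_right, inner_zero_left, mul_zero,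
    integral_zero, Finset.sum_const_zero, zero_add, sub_zero] at h
  rw [hK.sum_cellFacets fun F => ∫ x, (inner ℝ (polyVec (X.flux K) x) (outwardNormal K F) -
    singleFacetStabilization aK Fstar K F * (polyVal (X.pot K) x - polyVal (X.hat F) x)) *
      polyVal v x ∂(facetMeasure F)] at h
  have hdiv := hK.integral_polyDiv_mul hd (X.flux K) v
  have hsplit : ∀ u ∈ K, ∫ x, (inner ℝ (polyVec (X.flux K) x)
      (outwardNormal K (oppositeFacet K u)) -
      singleFacetStabilization aK Fstar K (oppositeFacet K u) *
        (polyVal (X.pot K) x - polyVal (X.hat (oppositeFacet K u)) x)) *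
      polyVal v x ∂(facetMeasure (oppositeFacet K u)) =
      ∫ x, inner ℝ (polyVec (X.flux K) x) (outwardNormal K (oppositeFacet K u)) * polyVal v x
        ∂(facetMeasure (oppositeFacet K u)) -
      singleFacetStabilization aK Fstar K (oppositeFacet K u) *
        ∫ x, polyVal (X.pot K - X.hat (oppositeFacet K u)) x * polyVal v x
        ∂(facetMeasure (oppositeFacet K u)) := by
    intro u hu
    rw [← integral_const_mul, ← integral_sub]
    · refine integral_congr_ae (Eventually.of_forall fun x => ?_)
      simp only [polyVal_sub]
      ring
    · exact hK.integrable_facetMeasure hd hu (by fun_prop)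
    · exact hK.integrable_facetMeasure hd hu (by fun_prop)
  rw [Finset.sum_congr rfl hsplit, Finset.sum_sub_distrib, ← hdiv] at h
  have hone : ∑ u ∈ K, singleFacetStabilization aK Fstar K (oppositeFacet K u) *
      ∫ x, polyVal (X.pot K - X.hat (oppositeFacet K u)) x * polyVal v x
        ∂(facetMeasure (oppositeFacet K u)) =
      aK K * ∫ x, polyVal (X.pot K - X.hat (Fstar K)) x * polyVal v x
        ∂(facetMeasure (Fstar K)) := by
    rw [← hK.sum_cellFacets fun F => singleFacetStabilization aK Fstar K F *
      ∫ x, polyVal (X.pot K - X.hat F) x * polyVal v x ∂(facetMeasure F),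
      Finset.sum_eq_single (Fstar K)]
    · simp [singleFacetStabilization]
    · intro F _ hne
      simp [singleFacetStabilization, hne]
    · exact fun hn => absurd (hK.mem_cellFacets_iff.2 ⟨w, hw, hF.symm⟩) hn
  rw [hone] at h
  have hadd : ∫ x, (f x + polyDiv (X.flux K) x) * polyVal v x ∂(cellMeasure K) =
      ∫ x, f x * polyVal v x ∂(cellMeasure K) +
        ∫ x, polyDiv (X.flux K) x * polyVal v x ∂(cellMeasure K) := by
    simp_rw [add_mul]
    rw [integral_add]
    · exact hf.integrable_mul (memLp_cellMeasure K (continuous_polyVal v))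
    · exact integrable_cellMeasure (by fun_prop)
  rw [hadd, ← h]
  ring

/-- The jump on the stabilized facet is bounded by the residual, tested with the extension of the
jump by the retraction of the element onto the facet. -/
lemma sq_mul_sq_jump_le (hd : 1 ≤ d) {T : Mesh d} {Ω : Set (Space d)} {k : ℕ}
    {aK : Finset (Space d) → ℝ} {Fstar : Finset (Space d) → Finset (Space d)} {f : Space d → ℝ}
    {X : DiscreteTriple d}
    (hX : IsMixedHDGSolution T Ω k aK (singleFacetStabilization aK Fstar) f X)
    {K : Finset (Space d)} (hKT : K ∈ T.cells) (haK : 0 < aK K) (hf : MemLp f 2 (cellMeasure K))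
    {w : Space d} (hw : w ∈ K) (hF : Fstar K = oppositeFacet K w)
    (p : MvPolynomial (Fin d) ℝ) :
    aK K ^ 2 * l2norm (facetMeasure (Fstar K)) (polyVal (X.pot K - X.hat (Fstar K))) ^ 2 ≤
      meshSize K * (l2norm (cellMeasure K) (fun x => f x - polyVal p x) +
        l2norm (cellMeasure K) (polyVal (p + divPoly (X.flux K)))) ^ 2 := by
  have hK := T.isSimplex hKT
  obtain ⟨w', hw', hne⟩ := hK.exists_mem_ne hd w
  set W := X.pot K - X.hat (Fstar K) with hW
  have hWdeg : W.totalDegree ≤ k := (MvPolynomial.totalDegree_sub _ _).trans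
    (max_le (hX.1.2.1 K hKT) (hX.1.2.2.1 _ ⟨K, hKT, hK.mem_cellFacets_iff.2 ⟨w, hw, hF.symm⟩⟩))
  obtain ⟨ℓ, hℓ, hℓb⟩ := exists_polyVal_affineMap (hK.bary w)
  -- `v` is the jump composed with the retraction of `K` onto the facet that sends `w` to `w'`.
  obtain ⟨v, hv, hvW⟩ := exists_polyVal_comp hWdeg (A := fun x => x - hK.bary w x • (w - w'))
    fun i => ⟨MvPolynomial.X i + MvPolynomial.C (-(w - w') i) * ℓ,
      totalDegree_add_le_of_le (MvPolynomial.totalDegree_X i).le (totalDegree_C_mul_le _ hℓ),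
      fun x => by
        rw [polyVal_add, polyVal_mul, hℓb]
        simp [polyVal]
        ring⟩
  have hjump := integral_jump_mul_eq hd hX hKT hf hw hF hv
  rw [← hW] at hjump
  have mW : MemLp (polyVal W) 2 (facetMeasure (Fstar K)) := by
    rw [hF]; exact hK.memLp_facetMeasure hd hw (continuous_polyVal W)
  have mv := memLp_cellMeasure K (continuous_polyVal v)
  have mR := memLp_cellMeasure K (continuous_polyVal (p + divPoly (X.flux K)))
  have mfp : MemLp (fun x => f x - polyVal p x) 2 (cellMeasure K) :=
    hf.sub (memLp_cellMeasure K (continuous_polyVal p))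
  have hvF : ∫ x, polyVal W x * polyVal v x ∂(facetMeasure (Fstar K)) =
      l2norm (facetMeasure (Fstar K)) (polyVal W) ^ 2 := by
    rw [l2norm_sq_real mW, hF, facetMeasure]
    refine setIntegral_congr_fun (isCompact_hull _).measurableSet fun x hx => ?_
    have h0 := (hK.mem_hull_oppositeFacet_iff.1 hx).2
    simp only [hvW, h0, zero_smul, sub_zero, sq]
  have hvK : l2norm (cellMeasure K) (polyVal v) ^ 2 ≤
      meshSize K * l2norm (facetMeasure (Fstar K)) (polyVal W) ^ 2 := by
    rw [l2norm_sq_real mv, l2norm_sq_real mW, hF]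
    simp_rw [hvW]
    exact hK.integral_comp_retraction_le hd hw hw' hne.symm
      (g := fun x => polyVal W x ^ 2) (by fun_prop) fun x => sq_nonneg _
  have hrhs : ∫ x, (f x + polyDiv (X.flux K) x) * polyVal v x ∂(cellMeasure K) ≤
      (l2norm (cellMeasure K) (fun x => f x - polyVal p x) +
        l2norm (cellMeasure K) (polyVal (p + divPoly (X.flux K)))) *
      l2norm (cellMeasure K) (polyVal v) := by
    have h1 : ∀ x, (f x + polyDiv (X.flux K) x) * polyVal v x = (f x - polyVal p x) * polyVal v x
        + polyVal (p + divPoly (X.flux K)) x * polyVal v x := by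
      intro x
      rw [polyVal_add, polyVal_divPoly]
      ring
    have i1 : Integrable (fun x => (f x - polyVal p x) * polyVal v x) (cellMeasure K) :=
      mfp.integrable_mul mv
    have i2 : Integrable (fun x => polyVal (p + divPoly (X.flux K)) x * polyVal v x)
        (cellMeasure K) := mR.integrable_mul mv
    simp_rw [h1]
    rw [integral_add i1 i2, add_mul]
    exact add_le_add ((le_abs_self _).trans (abs_integral_mul_le mfp mv))
      ((le_abs_self _).trans (abs_integral_mul_le mR mv))
  rw [hvF] at hjump
  rw [← hjump] at hrhs
  set j := l2norm (facetMeasure (Fstar K)) (polyVal W) with hj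
  set r := l2norm (cellMeasure K) (fun x => f x - polyVal p x) +
    l2norm (cellMeasure K) (polyVal (p + divPoly (X.flux K)))
  set t := l2norm (cellMeasure K) (polyVal v)
  have hj0 : 0 ≤ j := l2norm_nonneg _ _
  rcases hj0.eq_or_lt with hj0 | hj0
  · have : 0 ≤ meshSize K * r ^ 2 := mul_nonneg Metric.diam_nonneg (sq_nonneg _)
    rw [← hj0]
    simpa using this
  · have h2 : (aK K * j ^ 2) ^ 2 ≤ (r * t) ^ 2 := by gcongr
    have h3 : (aK K * j ^ 2) ^ 2 ≤ r ^ 2 * (meshSize K * j ^ 2) := by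
      refine h2.trans ?_
      rw [mul_pow]
      gcongr
    refine le_of_mul_le_mul_right ?_ (pow_pos hj0 2)
    calc aK K ^ 2 * j ^ 2 * j ^ 2 = (aK K * j ^ 2) ^ 2 := by ring
      _ ≤ r ^ 2 * (meshSize K * j ^ 2) := h3
      _ = _ := by ring

lemma integral_cellMeasure_eq_of_tsupport {K : Finset (Space d)} {g : Space d → ℝ}
    {φ : Space d → ℝ} (hφ : tsupport φ ⊆ interior (hull K)) (hg : ∀ x ∉ tsupport φ, g x = 0) :
    ∫ x, g x ∂(cellMeasure K) = ∫ x, g x := by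
  rw [cellMeasure_eq_restrict_interior]
  exact setIntegral_eq_integral_of_forall_compl_eq_zero fun x hx => hg x fun h => hx (hφ h)

lemma gradient_of_notMem_tsupport {φ : Space d → ℝ} {x : Space d} (hx : x ∉ tsupport φ) :
    gradient φ x = 0 := by
  rw [gradient, fderiv_of_notMem_tsupport ℝ hx, map_zero]

/-- Integration by parts against a function with compact support in an element. -/
lemma integral_polyDiv_mul_of_tsupport {K : Finset (Space d)} {φ : Space d → ℝ}
    (hφ : ContDiff ℝ ∞ φ) (hc : HasCompactSupport φ) (hs : tsupport φ ⊆ interior (hull K))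
    (p : Fin d → MvPolynomial (Fin d) ℝ) :
    ∫ x, polyDiv p x * φ x ∂(cellMeasure K) =
      - ∫ x, inner ℝ (polyVec p x) (gradient φ x) ∂(cellMeasure K) := by
  have hφ1 : ContDiff ℝ 1 φ := hφ.of_le (by exact_mod_cast le_top)
  rw [integral_cellMeasure_eq_of_tsupport hs fun x hx => by
      rw [image_eq_zero_of_notMem_tsupport hx, mul_zero],
    integral_cellMeasure_eq_of_tsupport hs fun x hx => by
      rw [gradient_of_notMem_tsupport hx, inner_zero_right]]
  have hdφ : ∀ i : Fin d, Continuous fun x => fderiv ℝ φ x (EuclideanSpace.single i 1) := fun i =>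
    (hφ1.continuous_fderiv one_ne_zero).clm_apply continuous_const
  have hcd : ∀ i : Fin d, HasCompactSupport fun x =>
      fderiv ℝ φ x (EuclideanSpace.single i 1) := fun i => by
    refine hc.mono' fun x hx => ?_
    by_contra h
    exact hx (by simp [fderiv_of_notMem_tsupport ℝ h])
  have i1 : ∀ (q : MvPolynomial (Fin d) ℝ), Integrable (fun x => polyVal q x * φ x) volume :=
    fun q => ((continuous_polyVal q).mul hφ.continuous).integrable_of_hasCompactSupport hc.mul_left
  have i2 : ∀ (q : MvPolynomial (Fin d) ℝ) (i : Fin d),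
      Integrable (fun x => polyVal q x * fderiv ℝ φ x (EuclideanSpace.single i 1)) volume :=
    fun q i => ((continuous_polyVal q).mul (hdφ i)).integrable_of_hasCompactSupport
      (hcd i).mul_left
  have hL : ∀ x, polyDiv p x * φ x = ∑ i, polyVal (MvPolynomial.pderiv i (p i)) x * φ x := by
    intro x; rw [polyDiv, Finset.sum_mul]
  have hR : ∀ x, inner ℝ (polyVec p x) (gradient φ x) =
      ∑ i, polyVal (p i) x * fderiv ℝ φ x (EuclideanSpace.single i 1) := by
    intro x
    rw [inner_polyVec]
    refine Finset.sum_congr rfl fun i _ => ?_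
    rw [← inner_gradient, EuclideanSpace.inner_single_right]
    simp
  simp_rw [hL, hR]
  rw [integral_finsetSum _ fun i _ => i1 _, integral_finsetSum _ fun i _ => i2 _ i,
    ← Finset.sum_neg_distrib]
  refine Finset.sum_congr rfl fun i _ => ?_
  have h := integral_mul_fderiv_eq_neg_fderiv_mul_of_integrable (μ := volume)
    (f := polyVal (p i)) (g := φ) (v := EuclideanSpace.single i (1 : ℝ))
    (by simpa only [fderiv_polyVal_single] using i1 _) (i2 _ i) (i1 _)
    (fun x _ => (contDiff_polyVal (p i) (n := 1)).differentiable one_ne_zero x)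
    (fun x _ => hφ1.differentiable one_ne_zero x)
  rw [h, neg_neg]
  simp_rw [fderiv_polyVal_single]

end

/-! ### The residual estimate and the equivalence of the seminorms -/

section

variable {d : ℕ}

/-- On an element the flux of a weak solution is square integrable. -/
lemma IsWeakSolution.memLp_flux {T : Mesh d} {Ω : Set (Space d)} (hΩ : T.Triangulates Ω)
    {a f : Space d → ℝ} {aK : Finset (Space d) → ℝ} (ha : IsPiecewiseConstant T a aK)
    {σ : Space d → Space d} {u : Space d → ℝ} (h : IsWeakSolution Ω a f σ u)
    {K : Finset (Space d)} (hK : K ∈ T.cells) : MemLp σ 2 (cellMeasure K) := by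
  obtain ⟨G, hG, hσ, -⟩ := h
  have hle := cellMeasure_le (hΩ.2 K hK)
  refine ((hG.2.1.mono_measure hle).const_smul (aK K)).ae_eq ?_
  have hint : ∀ᵐ x ∂(cellMeasure K), x ∈ interior (hull K) := by
    rw [cellMeasure_eq_restrict_interior]
    exact ae_restrict_mem isOpen_interior.measurableSet
  filter_upwards [hint, ae_mono hle hσ] with x hx hσx
  rw [hσx, (ha K hK).2 x hx]
  rfl

/-- Testing the weak form with a function supported in one element. -/
lemma IsWeakSolution.integral_cellMeasure {T : Mesh d} {Ω : Set (Space d)}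
    (hΩ : T.Triangulates Ω) {a f : Space d → ℝ} {σ : Space d → Space d} {u : Space d → ℝ}
    (h : IsWeakSolution Ω a f σ u) {K : Finset (Space d)} (hK : K ∈ T.cells) {φ : Space d → ℝ}
    (hφ : ContDiff ℝ ∞ φ) (hc : HasCompactSupport φ) (hs : tsupport φ ⊆ interior (hull K)) :
    ∫ x, inner ℝ (σ x) (gradient φ x) ∂(cellMeasure K) = ∫ x, f x * φ x ∂(cellMeasure K) := by
  obtain ⟨_, _, _, hweak⟩ := h
  have hsΩ := hs.trans (hΩ.2 K hK)
  have h1 : ∀ x ∉ tsupport φ, inner ℝ (σ x) (gradient φ x) = 0 := fun x hx => by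
    rw [gradient_of_notMem_tsupport hx, inner_zero_right]
  have h2 : ∀ x ∉ tsupport φ, f x * φ x = 0 := fun x hx => by
    rw [image_eq_zero_of_notMem_tsupport hx, mul_zero]
  rw [integral_cellMeasure_eq_of_tsupport hs h1, integral_cellMeasure_eq_of_tsupport hs h2,
    ← setIntegral_eq_integral_of_forall_compl_eq_zero fun x hx => h1 x fun h => hx (hsΩ h),
    ← setIntegral_eq_integral_of_forall_compl_eq_zero fun x hx => h2 x fun h => hx (hsΩ h)]
  exact hweak φ hφ hc hsΩ

/-- Local efficiency of the element residual `p + div τ`, by the bubble function technique. -/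
lemma exists_residual_bound (d k : ℕ) (κ : ℝ) :
    ∃ C : ℝ, 0 ≤ C ∧ ∀ {T : Mesh d} {Ω : Set (Space d)}, T.Triangulates Ω → T.ShapeRegular κ →
      ∀ {a f : Space d → ℝ} {aK : Finset (Space d) → ℝ}, IsPiecewiseConstant T a aK →
      MemLp f 2 (volume.restrict Ω) → ∀ {σ : Space d → Space d} {u : Space d → ℝ},
      IsWeakSolution Ω a f σ u → ∀ {K : Finset (Space d)}, K ∈ T.cells →
      ∀ {τ : Fin d → MvPolynomial (Fin d) ℝ}, (∀ i, (τ i).totalDegree ≤ k) →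
      ∀ {p : MvPolynomial (Fin d) ℝ}, p.totalDegree ≤ k →
      meshSize K * l2norm (cellMeasure K) (polyVal (p + divPoly τ)) ≤
        C * (meshSize K * l2norm (cellMeasure K) (fun x => f x - polyVal p x) +
          l2norm (cellMeasure K) (fun x => σ x - polyVec τ x)) := by
  obtain ⟨C, hC, hbub⟩ := exists_bubble d k κ
  refine ⟨C + C ^ 2, by positivity, ?_⟩
  intro T Ω hΩ hreg a f aK ha hf σ u hu K hK τ hτ p hp
  obtain ⟨z, ρ, hρ, hball, hκ⟩ := hreg K hK
  set R := p + divPoly τ with hR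
  obtain ⟨φ, hφ, hc, hs, hb1, hb2, hb3⟩ := hbub K z ρ hρ hball hκ R
    (totalDegree_add_le_of_le hp (totalDegree_divPoly_le hτ))
  have hφ1 : ContDiff ℝ 1 φ := hφ.of_le (by exact_mod_cast le_top)
  have mf := hf.mono_measure (cellMeasure_le (hΩ.2 K hK))
  have mσ := hu.memLp_flux hΩ ha hK
  have mφ := memLp_cellMeasure K hφ.continuous
  have mg := memLp_cellMeasure K (continuous_gradient hφ1)
  have mp := memLp_cellMeasure K (continuous_polyVal p)
  have mτ := memLp_cellMeasure K (continuous_polyVec τ)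
  have mdiv := memLp_cellMeasure K (continuous_polyDiv τ)
  have i1 : Integrable (fun x => polyVal p x * φ x) (cellMeasure K) := mp.integrable_mul mφ
  have i2 : Integrable (fun x => polyDiv τ x * φ x) (cellMeasure K) := mdiv.integrable_mul mφ
  have i3 : Integrable (fun x => f x * φ x) (cellMeasure K) := mf.integrable_mul mφ
  have i4 : Integrable (fun x => inner ℝ (σ x) (gradient φ x)) (cellMeasure K) :=
    integrable_inner_of_memLp mσ mg
  have i5 : Integrable (fun x => inner ℝ (polyVec τ x) (gradient φ x)) (cellMeasure K) :=
    integrable_inner_of_memLp mτ mg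
  have hid : ∫ x, polyVal R x * φ x ∂(cellMeasure K) =
      ∫ x, inner ℝ (σ x - polyVec τ x) (gradient φ x) ∂(cellMeasure K) -
        ∫ x, (f x - polyVal p x) * φ x ∂(cellMeasure K) := by
    simp_rw [hR, polyVal_add, polyVal_divPoly, add_mul, sub_mul, inner_sub_left]
    rw [integral_add i1 i2, integral_sub i4 i5, integral_sub i3 i1,
      integral_polyDiv_mul_of_tsupport hφ hc hs, hu.integral_cellMeasure hΩ hK hφ hc hs]
    ring
  have hle : ∫ x, polyVal R x * φ x ∂(cellMeasure K) ≤
      l2norm (cellMeasure K) (fun x => σ x - polyVec τ x) * l2norm (cellMeasure K) (gradient φ) +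
      l2norm (cellMeasure K) (fun x => f x - polyVal p x) * l2norm (cellMeasure K) φ := by
    rw [hid, sub_eq_add_neg]
    refine add_le_add ?_ ?_
    · exact (le_abs_self _).trans (abs_integral_inner_le (mσ.sub mτ) mg)
    · exact (neg_le_abs _).trans (abs_integral_mul_le (mf.sub mp) mφ)
  set r := l2norm (cellMeasure K) (polyVal R)
  set s := l2norm (cellMeasure K) (fun x => σ x - polyVec τ x)
  set t := l2norm (cellMeasure K) (fun x => f x - polyVal p x)
  have hr : 0 ≤ r := l2norm_nonneg _ _
  have hs0 : 0 ≤ s := l2norm_nonneg _ _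
  have ht0 : 0 ≤ t := l2norm_nonneg _ _
  have hh : 0 ≤ meshSize K := Metric.diam_nonneg
  rcases hr.eq_or_lt with hr | hr
  · rw [← hr, mul_zero]
    positivity
  · refine le_of_mul_le_mul_right ?_ hr
    calc meshSize K * r * r = meshSize K * r ^ 2 := by ring
      _ ≤ meshSize K * (C * (s * l2norm (cellMeasure K) (gradient φ) +
          t * l2norm (cellMeasure K) φ)) := by
          gcongr
          exact hb2.trans (mul_le_mul_of_nonneg_left hle hC)
      _ = C * s * (meshSize K * l2norm (cellMeasure K) (gradient φ)) +
          C * (meshSize K * t) * l2norm (cellMeasure K) φ := by ring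
      _ ≤ C * s * (C * r) + C * (meshSize K * t) * r := by gcongr
      _ = (C ^ 2 * s + C * (meshSize K * t)) * r := by ring
      _ ≤ (C + C ^ 2) * (meshSize K * t + s) * r := by
          gcongr
          nlinarith [mul_nonneg hC hs0, mul_nonneg (sq_nonneg C) (mul_nonneg hh ht0)]

/-- The stabilization term on one element is controlled by the flux error and the oscillation. -/
lemma exists_jump_bound (d k : ℕ) (hd : 1 ≤ d) (κ : ℝ) :
    ∃ D : ℝ, 0 ≤ D ∧ ∀ {T : Mesh d} {Ω : Set (Space d)}, T.Triangulates Ω → T.ShapeRegular κ →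
      ∀ {a f : Space d → ℝ} {aK : Finset (Space d) → ℝ}, IsPiecewiseConstant T a aK →
      MemLp f 2 (volume.restrict Ω) → ∀ {σ : Space d → Space d} {u : Space d → ℝ},
      IsWeakSolution Ω a f σ u → ∀ {Fstar : Finset (Space d) → Finset (Space d)},
      ∀ {X : DiscreteTriple d},
      IsMixedHDGSolution T Ω k aK (singleFacetStabilization aK Fstar) f X →
      ∀ {K : Finset (Space d)}, K ∈ T.cells → Fstar K ∈ cellFacets K →
      meshSize K * (aK K *
        l2norm (facetMeasure (Fstar K)) (polyVal (X.pot K - X.hat (Fstar K))) ^ 2) ≤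
      D * ((aK K)⁻¹ * l2norm (cellMeasure K) (fun x => σ x - polyVec (X.flux K) x) ^ 2 +
        osc aK k f K ^ 2) := by
  obtain ⟨C, hC, hres⟩ := exists_residual_bound d k κ
  refine ⟨2 * (1 + C) ^ 2, by positivity, ?_⟩
  intro T Ω hΩ hreg a f aK ha hf σ u hu Fstar X hX K hK hFK
  obtain ⟨w, hw, hF⟩ := (T.isSimplex hK).mem_cellFacets_iff.1 hFK
  have hα : 0 < aK K := (ha K hK).1
  have mf := hf.mono_measure (cellMeasure_le (hΩ.2 K hK))
  set s := l2norm (cellMeasure K) (fun x => σ x - polyVec (X.flux K) x)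
  set j := l2norm (facetMeasure (Fstar K)) (polyVal (X.pot K - X.hat (Fstar K)))
  set b := (√(aK K))⁻¹ * meshSize K with hb
  have hh : 0 ≤ meshSize K := Metric.diam_nonneg
  have hs0 : 0 ≤ s := l2norm_nonneg _ _
  have hbsq : b ^ 2 = (aK K)⁻¹ * meshSize K ^ 2 := by
    rw [hb, mul_pow, inv_pow, Real.sq_sqrt hα.le]
  have hp : ∀ p : {p : MvPolynomial (Fin d) ℝ // p.totalDegree ≤ k},
      meshSize K * (aK K * j ^ 2) ≤ 2 * (1 + C) ^ 2 * ((aK K)⁻¹ * s ^ 2 +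
        (b * √(∫ x, (f x - polyVal p.1 x) ^ 2 ∂(cellMeasure K))) ^ 2) := by
    intro p
    have mfp : MemLp (fun x => f x - polyVal p.1 x) 2 (cellMeasure K) :=
      mf.sub (memLp_cellMeasure K (continuous_polyVal p.1))
    have ht : √(∫ x, (f x - polyVal p.1 x) ^ 2 ∂(cellMeasure K)) =
        l2norm (cellMeasure K) (fun x => f x - polyVal p.1 x) := by
      rw [← l2norm_sq_real mfp, Real.sqrt_sq (l2norm_nonneg _ _)]
    have h1 := sq_mul_sq_jump_le hd hX hK hα mf hw hF.symm p.1
    have h2 := hres hΩ hreg ha hf hu hK (hX.1.1 K hK) p.2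
    rw [ht]
    set t := l2norm (cellMeasure K) (fun x => f x - polyVal p.1 x)
    set r := l2norm (cellMeasure K) (polyVal (p.1 + divPoly (X.flux K)))
    have ht0 : 0 ≤ t := l2norm_nonneg _ _
    have hr0 : 0 ≤ r := l2norm_nonneg _ _
    have h3 : meshSize K * (t + r) ≤ (1 + C) * (meshSize K * t + s) := by
      linarith
    have h4 : (meshSize K * (t + r)) ^ 2 ≤
        (1 + C) ^ 2 * (2 * (meshSize K * t) ^ 2 + 2 * s ^ 2) := by
      calc (meshSize K * (t + r)) ^ 2 ≤ ((1 + C) * (meshSize K * t + s)) ^ 2 := by gcongr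
        _ = (1 + C) ^ 2 * (meshSize K * t + s) ^ 2 := by ring
        _ ≤ _ := by
          gcongr
          nlinarith [sq_nonneg (meshSize K * t - s)]
    calc meshSize K * (aK K * j ^ 2) = (aK K)⁻¹ * (meshSize K * (aK K ^ 2 * j ^ 2)) := by
          field_simp
      _ ≤ (aK K)⁻¹ * (meshSize K * (meshSize K * (t + r) ^ 2)) := by gcongr
      _ = (aK K)⁻¹ * (meshSize K * (t + r)) ^ 2 := by ring
      _ ≤ (aK K)⁻¹ * ((1 + C) ^ 2 * (2 * (meshSize K * t) ^ 2 + 2 * s ^ 2)) := by gcongr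
      _ = 2 * (1 + C) ^ 2 * ((aK K)⁻¹ * s ^ 2 + (b * t) ^ 2) := by
          rw [mul_pow b, hbsq]; ring
  -- The bound holds for each polynomial, and passes to the infimum along a minimizing sequence.
  obtain ⟨v, -, hv, hvm⟩ := exists_seq_tendsto_sInf
    (S := Set.range fun p : {p : MvPolynomial (Fin d) ℝ // p.totalDegree ≤ k} =>
      √(∫ x, (f x - polyVal p.1 x) ^ 2 ∂(cellMeasure K)))
    ⟨_, ⟨0, by simp⟩, rfl⟩ ⟨0, by rintro _ ⟨p, rfl⟩; exact Real.sqrt_nonneg _⟩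
  have hlim := (((hv.const_mul b).pow 2).const_add ((aK K)⁻¹ * s ^ 2)).const_mul (2 * (1 + C) ^ 2)
  refine ge_of_tendsto' hlim fun n => ?_
  obtain ⟨p, hpn⟩ := hvm n
  rw [← hpn]
  exact hp p

lemma hdgSeminorm_sq {T : Mesh d} {aK : Finset (Space d) → ℝ}
    {α : Finset (Space d) → Finset (Space d) → ℝ} (hα : ∀ K ∈ T.cells, ∀ F, 0 ≤ α K F)
    (e : BrokenTriple d) :
    brokenSeminorm T aK e ^ 2 ≤ hdgSeminorm T aK α e ^ 2 ∧
    hdgSeminorm T aK α e ^ 2 = brokenSeminorm T aK e ^ 2 +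
      ∑ K ∈ T.cells, meshSize K * ∑ F ∈ cellFacets K,
        ∫ x, α K F * (facetTrace K F (e.pot K) x - e.hat F x) ^ 2 ∂(facetMeasure F) := by
  have hnn : 0 ≤ ∑ K ∈ T.cells, meshSize K * ∑ F ∈ cellFacets K,
        ∫ x, α K F * (facetTrace K F (e.pot K) x - e.hat F x) ^ 2 ∂(facetMeasure F) :=
    Finset.sum_nonneg fun K hK => mul_nonneg Metric.diam_nonneg (Finset.sum_nonneg fun F _ =>
      integral_nonneg fun x => mul_nonneg (hα K hK F) (sq_nonneg _))
  have h : hdgSeminorm T aK α e ^ 2 = brokenSeminorm T aK e ^ 2 +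
      ∑ K ∈ T.cells, meshSize K * ∑ F ∈ cellFacets K,
        ∫ x, α K F * (facetTrace K F (e.pot K) x - e.hat F x) ^ 2 ∂(facetMeasure F) := by
    rw [hdgSeminorm, Real.sq_sqrt (add_nonneg (sq_nonneg _) hnn)]
  exact ⟨by rw [h]; linarith, h⟩

/-- The stabilization part of the error on one element is the jump of the discrete potentials. -/
lemma sum_stabilization_error (hd : 1 ≤ d) {T : Mesh d} {Ω : Set (Space d)}
    (hΩ : T.Triangulates Ω) {u : Space d → ℝ} {G : Space d → Space d} (hu : IsH10 Ω u G)
    (aK : Finset (Space d) → ℝ) {Fstar : Finset (Space d) → Finset (Space d)}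
    (σ : Space d → Space d) (X : DiscreteTriple d) {K : Finset (Space d)} (hK : K ∈ T.cells)
    (hFK : Fstar K ∈ cellFacets K) :
    ∑ F ∈ cellFacets K, ∫ x, singleFacetStabilization aK Fstar K F *
      (facetTrace K F ((errorTriple T σ u X).pot K) x - (errorTriple T σ u X).hat F x) ^ 2
        ∂(facetMeasure F) =
    aK K * l2norm (facetMeasure (Fstar K)) (polyVal (X.pot K - X.hat (Fstar K))) ^ 2 := by
  obtain ⟨w, hw, hF⟩ := (T.isSimplex hK).mem_cellFacets_iff.1 hFK
  rw [Finset.sum_eq_single (Fstar K)]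
  · have mW : MemLp (polyVal (X.pot K - X.hat (Fstar K))) 2 (facetMeasure (Fstar K)) := by
      rw [← hF]
      exact (T.isSimplex hK).memLp_facetMeasure hd hw (continuous_polyVal _)
    rw [l2norm_sq_real mW, ← integral_const_mul]
    refine integral_congr_ae ?_
    have h := facetTrace_sub_skeletonTrace hd hΩ.2 hu hK hw
      (contDiff_polyVal (X.pot K) (n := ∞))
    rw [hF] at h
    filter_upwards [h] with x hx
    simp only [errorTriple, singleFacetStabilization, if_true, hx, polyVal_sub]
    ring
  · intro F _ hne
    simp [singleFacetStabilization, hne]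
  · exact fun h => absurd hFK h

lemma brokenSeminorm_error_sq {T : Mesh d} {Ω : Set (Space d)} (hΩ : T.Triangulates Ω)
    {a f : Space d → ℝ} {aK : Finset (Space d) → ℝ} (ha : IsPiecewiseConstant T a aK)
    {σ : Space d → Space d} {u : Space d → ℝ} (hu : IsWeakSolution Ω a f σ u)
    (X : DiscreteTriple d) :
    brokenSeminorm T aK (errorTriple T σ u X) ^ 2 =
      ∑ K ∈ T.cells, (aK K)⁻¹ *
        l2norm (cellMeasure K) (fun x => σ x - polyVec (X.flux K) x) ^ 2 := by
  have h : ∀ K ∈ T.cells, ∫ x, (aK K)⁻¹ * inner ℝ ((errorTriple T σ u X).flux K x)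
      ((errorTriple T σ u X).flux K x) ∂(cellMeasure K) =
      (aK K)⁻¹ * l2norm (cellMeasure K) (fun x => σ x - polyVec (X.flux K) x) ^ 2 := by
    intro K hK
    have me : MemLp (fun x => σ x - polyVec (X.flux K) x) 2 (cellMeasure K) :=
      (hu.memLp_flux hΩ ha hK).sub (memLp_cellMeasure K (continuous_polyVec (X.flux K)))
    rw [integral_const_mul, l2norm_sq me]
    rfl
  rw [brokenSeminorm, Real.sq_sqrt, Finset.sum_congr rfl h]
  rw [Finset.sum_congr rfl h]
  exact Finset.sum_nonneg fun K hK => mul_nonneg (inv_nonneg.2 (ha K hK).1.le) (sq_nonneg _)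

end

end

end HDG

theorem mainTheorem5 (d : ℕ) (hd : d = 2 ∨ d = 3) (k : ℕ) (κ : ℝ) :
    ∃ c : ℝ, 0 < c ∧
      ∀ (Ω : Set (HDG.Space d)) (T : HDG.Mesh d),
        IsOpen Ω → SimplyConnectedSpace Ω → T.Triangulates Ω → T.ShapeRegular κ →
      ∀ (a : HDG.Space d → ℝ) (aK : Finset (HDG.Space d) → ℝ),
        HDG.IsPiecewiseConstant T a aK →
      ∀ f : HDG.Space d → ℝ, MemLp f 2 (volume.restrict Ω) →
      ∀ (σ : HDG.Space d → HDG.Space d) (u : HDG.Space d → ℝ),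
        HDG.IsWeakSolution Ω a f σ u →
      ∀ Fstar : Finset (HDG.Space d) → Finset (HDG.Space d),
        (∀ K ∈ T.cells, Fstar K ∈ HDG.cellFacets K) →
      ∀ X : HDG.DiscreteTriple d,
        HDG.IsMixedHDGSolution T Ω k aK (HDG.singleFacetStabilization aK Fstar) f X →
        HDG.brokenSeminorm T aK (HDG.errorTriple T σ u X) ≤
          HDG.hdgSeminorm T aK (HDG.singleFacetStabilization aK Fstar)
            (HDG.errorTriple T σ u X) ∧
        c * HDG.hdgSeminorm T aK (HDG.singleFacetStabilization aK Fstar)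
            (HDG.errorTriple T σ u X) ^ 2 ≤
          HDG.brokenSeminorm T aK (HDG.errorTriple T σ u X) ^ 2 +
            ∑ K ∈ T.cells, HDG.osc aK k f K ^ 2 := by
  have hd1 : 1 ≤ d := by omega
  obtain ⟨D, hD, hjump⟩ := HDG.exists_jump_bound d k hd1 κ
  refine ⟨(1 + D)⁻¹, by positivity, ?_⟩
  intro Ω T _ _ hΩ hreg a aK ha f hf σ u hu Fstar hFstar X hX
  have hα : ∀ K ∈ T.cells, ∀ F, 0 ≤ HDG.singleFacetStabilization aK Fstar K F := by
    intro K hK F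
    rw [HDG.singleFacetStabilization]
    split_ifs
    · exact (ha K hK).1.le
    · exact le_rfl
  obtain ⟨hle, heq⟩ := HDG.hdgSeminorm_sq (aK := aK) hα (HDG.errorTriple T σ u X)
  refine ⟨(le_abs_self _).trans (abs_le_of_sq_le_sq hle (Real.sqrt_nonneg _)), ?_⟩
  rw [inv_mul_le_iff₀ (by positivity), heq]
  have hG : ∃ G, HDG.IsH10 Ω u G := by
    obtain ⟨G, hG, -⟩ := hu
    exact ⟨G, hG⟩
  obtain ⟨G, hG⟩ := hG
  have hsum : ∑ K ∈ T.cells, HDG.meshSize K * ∑ F ∈ HDG.cellFacets K,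
      ∫ x, HDG.singleFacetStabilization aK Fstar K F *
        (HDG.facetTrace K F ((HDG.errorTriple T σ u X).pot K) x -
          (HDG.errorTriple T σ u X).hat F x) ^ 2 ∂(HDG.facetMeasure F) ≤
      D * (HDG.brokenSeminorm T aK (HDG.errorTriple T σ u X) ^ 2 +
        ∑ K ∈ T.cells, HDG.osc aK k f K ^ 2) := by
    rw [HDG.brokenSeminorm_error_sq hΩ ha hu, ← Finset.sum_add_distrib, Finset.mul_sum]
    refine Finset.sum_le_sum fun K hK => ?_
    rw [HDG.sum_stabilization_error hd1 hΩ hG aK σ X hK (hFstar K hK)]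
    exact hjump hΩ hreg ha hf hu hX hK (hFstar K hK)
  have hosc : 0 ≤ ∑ K ∈ T.cells, HDG.osc aK k f K ^ 2 :=
    Finset.sum_nonneg fun K _ => sq_nonneg _
  linarith
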